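/- An overpartition of a nonnegative integer $n$ is a partition of $n$ in which the first occurrence of each distinct part may be overlined. Let $\overline{p}(n)$ denote the number of overpartitions of $n$. (1) For all integers $n > m \geq 1$, $$\overline{p}(n)^2-\overline{p}(n-m)\,\overline{p}(n+m)\geq 0,$$ with equality if and only if $(n,m)=(2,1)$. (2) For all integers $a,b>1$, $$\overline{p}(a)\,\overline{p}(b)>\overline{p}(a+b).$$ -/

import Mathlib

/-- An overpartition of `n`: a partition of `n` in which, for each value occurring as a part, the
first occurrence of that value may or may not be overlined. The overlining is recorded by the set
of those part values whose first occurrence is overlined. -/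
@[ext]
structure Overpartition (n : ℕ) where
  /-- the underlying partition of `n` -/
  partition : n.Partition
  /-- the values whose first occurrence is overlined -/
  overlined : Finset ℕ
  /-- only parts of the partition can be overlined -/
  overlined_subset : overlined ⊆ partition.parts.toFinset

/-- An overpartition is a partition together with a subset of its set of distinct parts. -/
def Overpartition.equivSigma (n : ℕ) :
    (Σ p : n.Partition, {s : Finset ℕ // s ∈ p.parts.toFinset.powerset}) ≃ Overpartition n where
  toFun x := ⟨x.1, x.2.1, Finset.mem_powerset.mp x.2.2⟩
  invFun x := ⟨x.partition, x.overlined, Finset.mem_powerset.mpr x.overlined_subset⟩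
  left_inv _ := rfl
  right_inv _ := rfl

/-- There are finitely many overpartitions of `n`. -/
instance Overpartition.instFintype (n : ℕ) : Fintype (Overpartition n) :=
  Fintype.ofEquiv _ (Overpartition.equivSigma n)

/-- The overpartition function: the number of overpartitions of `n`. -/
def overpartitionCount (n : ℕ) : ℕ :=
  Fintype.card (Overpartition n)

/-! The theorem reduces to the strict log-concavity `p̄(k) p̄(k + 2) < p̄(k + 1) ^ 2` for `k ≥ 2`
(`logConcave`): then the ratios `p̄(k + 1) / p̄(k)` decrease, strictly from `k = 2` on, and both
parts follow by moving one unit at a time from one argument to the other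
(`overpartitionCount_sub_mul_add_lt`, `overpartitionCount_add_lt_of_le`). The values at `k = 0, 1`
are equalities, `1 · 4 = 2 ^ 2` and `2 · 8 = 4 ^ 2`; the second one is the exceptional case
`(n, m) = (2, 1)`.

The generating function is `P(q) = ∑ p̄(n) q^n = ∏ (1 + q^i) / (1 - q^i)`
(`tendsto_overpartitionProd`), and Gauss's identity `P(q) ∑ (-1)^k q^(k^2) = 1`
(`overpartitionGF_mul_theta`), the sum over all integers `k`, is used twice.

* Comparing coefficients gives the recurrence `p̄(n) = 2 (p̄(n - 1) - p̄(n - 4) + p̄(n - 9) - ⋯)`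
  (`overpartitionCount_eq_altSquareSum`), which is cheap enough to verify log-concavity for
  `k < 640` by evaluation (`logConcave_of_lt`).
* The modular transformation of the theta function shows that `P(exp(-z))` is close to
  `g(z) = (1/2) √(z/π) exp(π²/(4z))` near `z = 0` (`norm_overpartitionGF_sub_mainTerm_le`). Away
  from there `|P|` is small, because the factor `exp(2q/(1 - q))` of `P` already is
  (`norm_overpartitionGF_minor_le`).

For large `n`, one compares `2π p̄(n) = ∫ P(exp(-z)) exp(nz) dθ`, along the segment `z = y + iθ`,
`|θ| ≤ π`, with `y = π/(2√n)` the saddle point of `g(z) exp(nz)`, to the inverse Laplace transform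
of `g`. Since `g(z)` grows at infinity, the latter is replaced by that of `g''`, which is
integrable on vertical lines: Gaussian moments show that `g''` is the Laplace transform of an
explicit function (`integral_laplaceKernel`), Fourier inversion inverts this
(`integral_mainTermDerivTwo_lineAt`), and `n² g - g''` has the elementary primitive
`(n g - g') exp(nz)` against `exp(nz)`, which contributes only boundary terms. The outcome
(`abs_sub_laplaceKernel_le`, `abs_overpartitionCount_sub_le`) is
`p̄(n) ≈ exp(π√n) (1 - 1/(π√n)) / (8n)` with an exponentially small relative error. The logarithmic
second difference of `exp(π√n)` is about `-(π/4) n^(-3/2)`, that of `1/n` only of order `n^(-2)`,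
and `1 - 1/(π√n)` is concave, so log-concavity holds as soon as `n` is moderately large
(`logConcave_of_ge`). -/

section

open PowerSeries Filter Topology
open scoped PowerSeries.WithPiTopology

/-! ### The generating function of overpartitions -/

/-- An overpartition with underlying partition `p` is a choice of a set of distinct parts. -/
lemma overpartitionCount_eq_sum (n : ℕ) :
    overpartitionCount n = ∑ p : n.Partition, 2 ^ p.parts.toFinset.card := by
  rw [overpartitionCount, ← Fintype.card_congr (Overpartition.equivSigma n), Fintype.card_sigma]
  refine Finset.sum_congr rfl fun p _ => ?_
  rw [Fintype.card_coe, Finset.card_powerset]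

lemma genFun_two_coeff (n : ℕ) :
    (Nat.Partition.genFun (fun _ _ => (2 : ℝ))).coeff n = overpartitionCount n := by
  rw [Nat.Partition.coeff_genFun, overpartitionCount_eq_sum]
  push_cast
  refine Finset.sum_congr rfl fun p _ => ?_
  rw [Finsupp.prod, Finset.prod_const, Multiset.toFinsupp_support]

/-- The power series `1 + 2X^k + 2X^(2k) + ⋯ = (1 + X^k) / (1 - X^k)` with `k = i + 1`: the
contribution of the parts equal to `i + 1`. -/
noncomputable def overpartitionFactor (i : ℕ) : ℝ⟦X⟧ :=
  PowerSeries.mk fun n => if n = 0 then 1 else if (i + 1) ∣ n then 2 else 0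

lemma overpartitionFactor_eq (i : ℕ) :
    overpartitionFactor i = 1 + ∑' j : ℕ, (2 : ℝ) • (X : ℝ⟦X⟧) ^ ((i + 1) * (j + 1)) := by
  have h : HasSum (fun j : ℕ => (2 : ℝ) • (X : ℝ⟦X⟧) ^ ((i + 1) * (j + 1)))
      (overpartitionFactor i - 1) := by
    rw [WithPiTopology.hasSum_iff_hasSum_coeff]
    intro n
    simp only [map_smul, coeff_X_pow, map_sub, overpartitionFactor, coeff_mk, coeff_one,
      smul_eq_mul]
    by_cases hn : n ≠ 0 ∧ (i + 1) ∣ n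
    · obtain ⟨hn0, k, rfl⟩ := hn
      obtain ⟨k, rfl⟩ : ∃ m, k = m + 1 := Nat.exists_eq_succ_of_ne_zero (by rintro rfl; simp at hn0)
      convert! hasSum_ite_eq k (2 : ℝ) using 2 with j
      · simp [eq_comm]
      · simp
    · convert! hasSum_zero using 2 with j
      · simp only [mul_ite, mul_one, mul_zero, ite_eq_right_iff, OfNat.ofNat_ne_zero, imp_false]
        rintro rfl
        exact hn ⟨by positivity, dvd_mul_right _ _⟩
      · by_cases h0 : n = 0
        · simp [h0]
        · have : ¬ (i + 1) ∣ n := fun h => hn ⟨h0, h⟩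
          simp [h0, this]
  rw [h.tsum_eq]; ring

lemma overpartitionFactor_coeff_nonneg (i n : ℕ) : 0 ≤ (overpartitionFactor i).coeff n := by
  simp only [overpartitionFactor, coeff_mk]
  split_ifs <;> norm_num

/-- `truncatedCount N n` is the number of overpartitions of `n` into parts of size at most `N`. -/
noncomputable def truncatedCount (N n : ℕ) : ℝ :=
  (∏ i ∈ Finset.range N, overpartitionFactor i).coeff n

lemma tendsto_truncatedCount (n : ℕ) :
    Tendsto (fun N => truncatedCount N n) atTop (𝓝 (overpartitionCount n : ℝ)) := by
  have h := Nat.Partition.hasProd_genFun (fun _ _ => (2 : ℝ))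
  simp only [← overpartitionFactor_eq] at h
  have h2 := (WithPiTopology.tendsto_iff_coeff_tendsto ..).1 h.tendsto_prod_nat n
  rwa [genFun_two_coeff] at h2

lemma truncatedCount_nonneg (N n : ℕ) : 0 ≤ truncatedCount N n := by
  induction N generalizing n with
  | zero => simp only [truncatedCount, Finset.range_zero, Finset.prod_empty, coeff_one]; positivity
  | succ N ih =>
    rw [truncatedCount, Finset.prod_range_succ, coeff_mul]
    exact Finset.sum_nonneg fun x _ => mul_nonneg (ih _) (overpartitionFactor_coeff_nonneg _ _)

lemma truncatedCount_mono (n : ℕ) : Monotone fun N => truncatedCount N n := by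
  refine monotone_nat_of_le_succ fun N => ?_
  rw [truncatedCount, truncatedCount, Finset.prod_range_succ, coeff_mul]
  refine le_trans (le_of_eq ?_) (Finset.single_le_sum (a := (n, 0)) (fun x _ =>
    mul_nonneg (truncatedCount_nonneg N x.1) (overpartitionFactor_coeff_nonneg N x.2)) (by simp))
  simp [overpartitionFactor]

lemma truncatedCount_le (N n : ℕ) : truncatedCount N n ≤ overpartitionCount n :=
  (truncatedCount_mono n).ge_of_tendsto (tendsto_truncatedCount n) N

lemma hasSum_overpartitionFactor (i : ℕ) {q : ℂ} (hq : ‖q‖ < 1) :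
    HasSum (fun n => ((overpartitionFactor i).coeff n : ℂ) * q ^ n)
      ((1 + q ^ (i + 1)) / (1 - q ^ (i + 1))) := by
  have hinj : Function.Injective fun j : ℕ => (i + 1) * j :=
    fun a b h => by simpa using h
  have hw : ‖q ^ (i + 1)‖ < 1 := by
    rw [norm_pow]; exact pow_lt_one₀ (norm_nonneg _) hq (by simp)
  have hw1 : 1 - q ^ (i + 1) ≠ 0 := by
    intro h
    rw [← sub_eq_zero.1 h] at hw
    simp at hw
  rw [← hinj.hasSum_iff]
  · have h1 := ((hasSum_geometric_of_norm_lt_one hw).mul_left 2).sub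
      (hasSum_ite_eq (0 : ℕ) (1 : ℂ))
    convert! h1 using 1
    · ext j
      simp only [Function.comp, overpartitionFactor, coeff_mk, pow_mul]
      rcases eq_or_ne j 0 with rfl | hj
      · norm_num
      · simp [hj]
    · field_simp; ring
  · intro n hn
    have h0 : n ≠ 0 := by rintro rfl; exact hn ⟨0, by simp⟩
    have h1 : ¬ (i + 1) ∣ n := by rintro ⟨k, rfl⟩; exact hn ⟨k, rfl⟩
    simp [overpartitionFactor, h0, h1]

lemma hasSum_coeff_mul {φ ψ : ℝ⟦X⟧} {q A B : ℂ}
    (hφ : HasSum (fun n => (φ.coeff n : ℂ) * q ^ n) A)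
    (hψ : HasSum (fun n => (ψ.coeff n : ℂ) * q ^ n) B) :
    HasSum (fun n => ((φ * ψ).coeff n : ℂ) * q ^ n) (A * B) := by
  have key : (fun n => ((φ * ψ).coeff n : ℂ) * q ^ n) = fun n =>
      ∑ kl ∈ Finset.HasAntidiagonal.antidiagonal n, ((φ.coeff kl.1 : ℂ) * q ^ kl.1) *
        ((ψ.coeff kl.2 : ℂ) * q ^ kl.2) := by
    ext n
    rw [coeff_mul]
    push_cast
    rw [Finset.sum_mul]
    refine Finset.sum_congr rfl fun x hx => ?_
    rw [← Finset.HasAntidiagonal.mem_antidiagonal.1 hx, pow_add]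
    ring
  have hφ' := hφ.summable.norm
  have hψ' := hψ.summable.norm
  rw [← hφ.tsum_eq, ← hψ.tsum_eq,
    tsum_mul_tsum_eq_tsum_sum_antidiagonal_of_summable_norm hφ' hψ', key]
  exact (summable_norm_sum_mul_antidiagonal_of_summable_norm hφ' hψ').of_norm.hasSum

lemma hasSum_truncatedCount (N : ℕ) {q : ℂ} (hq : ‖q‖ < 1) :
    HasSum (fun n => (truncatedCount N n : ℂ) * q ^ n)
      (∏ i ∈ Finset.range N, (1 + q ^ (i + 1)) / (1 - q ^ (i + 1))) := by
  induction N with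
  | zero =>
    simp only [truncatedCount, Finset.range_zero, Finset.prod_empty, coeff_one]
    convert! hasSum_ite_eq (0 : ℕ) (1 : ℂ) using 2 with n
    split_ifs with h <;> simp [h]
  | succ N ih =>
    simp only [truncatedCount, Finset.prod_range_succ] at ih ⊢
    exact hasSum_coeff_mul ih (hasSum_overpartitionFactor N hq)

lemma one_sub_pow_ne_zero {q : ℂ} (hq : ‖q‖ < 1) {m : ℕ} (hm : m ≠ 0) : 1 - q ^ m ≠ 0 := by
  intro h
  have : ‖q ^ m‖ < 1 := by rw [norm_pow]; exact pow_lt_one₀ (norm_nonneg _) hq hm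
  rw [← sub_eq_zero.1 h] at this
  simp at this

lemma one_add_pow_ne_zero {q : ℂ} (hq : ‖q‖ < 1) {m : ℕ} (hm : m ≠ 0) : 1 + q ^ m ≠ 0 := by
  intro h
  have : ‖q ^ m‖ < 1 := by rw [norm_pow]; exact pow_lt_one₀ (norm_nonneg _) hq hm
  rw [← neg_eq_of_add_eq_zero_right h] at this
  simp at this

lemma summable_norm_pow_succ {q : ℂ} (hq : ‖q‖ < 1) : Summable fun i : ℕ => ‖q ^ (i + 1)‖ := by
  simp only [norm_pow]
  exact (summable_nat_add_iff 1).2 (summable_geometric_of_lt_one (norm_nonneg _) hq)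

lemma exists_tendsto_prod_one_sub {q : ℂ} (hq : ‖q‖ < 1) :
    ∃ L : ℂ, L ≠ 0 ∧
      Tendsto (fun N => ∏ i ∈ Finset.range N, (1 - q ^ (i + 1))) atTop (𝓝 L) := by
  have hs : Summable fun i : ℕ => ‖-q ^ (i + 1)‖ := by simpa using summable_norm_pow_succ hq
  refine ⟨∏' i : ℕ, (1 + -q ^ (i + 1)), tprod_one_add_ne_zero_of_summable (fun i => ?_) hs, ?_⟩
  · rw [← sub_eq_add_neg]; exact one_sub_pow_ne_zero hq (by simp)
  · simpa [sub_eq_add_neg] using (multipliable_one_add_of_summable hs).hasProd.tendsto_prod_nat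

lemma exists_tendsto_prod_one_add {q : ℂ} (hq : ‖q‖ < 1) :
    ∃ L : ℂ, Tendsto (fun N => ∏ i ∈ Finset.range N, (1 + q ^ (i + 1))) atTop (𝓝 L) :=
  ⟨∏' i : ℕ, (1 + q ^ (i + 1)),
    (multipliable_one_add_of_summable (summable_norm_pow_succ hq)).hasProd.tendsto_prod_nat⟩

/-- The partial products of `∏ (1 + q^i) / (1 - q^i)`. -/
noncomputable def overpartitionProd (N : ℕ) (q : ℂ) : ℂ :=
  ∏ i ∈ Finset.range N, (1 + q ^ (i + 1)) / (1 - q ^ (i + 1))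

lemma exists_tendsto_overpartitionProd {q : ℂ} (hq : ‖q‖ < 1) :
    ∃ L : ℂ, Tendsto (fun N => overpartitionProd N q) atTop (𝓝 L) := by
  obtain ⟨A, hA⟩ := exists_tendsto_prod_one_add hq
  obtain ⟨B, hB, hB'⟩ := exists_tendsto_prod_one_sub hq
  refine ⟨A / B, ?_⟩
  simp only [overpartitionProd, Finset.prod_div_distrib]
  exact hA.div hB' hB

/-- The generating function `∑ p̄(n) q^n`. -/
noncomputable def overpartitionGF (q : ℂ) : ℂ := ∑' n : ℕ, (overpartitionCount n : ℂ) * q ^ n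

/-- The coefficients of the truncated products increase to `p̄(n)`, while the products stay bounded
at a real point, so the full series converges there. -/
lemma summable_overpartitionCount {r : ℝ} (h0 : 0 ≤ r) (h1 : r < 1) :
    Summable fun n => (overpartitionCount n : ℝ) * r ^ n := by
  have hr : ‖(r : ℂ)‖ < 1 := by simpa [abs_of_nonneg h0] using h1
  obtain ⟨L, hL⟩ := exists_tendsto_overpartitionProd hr
  refine summable_of_sum_range_le (c := ‖L‖) (fun n => by positivity) fun M => ?_
  have h2 : Tendsto (fun N => ∑ n ∈ Finset.range M, truncatedCount N n * r ^ n) atTop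
      (𝓝 (∑ n ∈ Finset.range M, (overpartitionCount n : ℝ) * r ^ n)) :=
    tendsto_finsetSum _ fun n _ => (tendsto_truncatedCount n).mul_const _
  refine le_of_tendsto_of_tendsto' h2 hL.norm fun N => ?_
  have h3 := hasSum_truncatedCount N hr
  have h4 : HasSum (fun n => truncatedCount N n * r ^ n) (overpartitionProd N r).re := by
    have := Complex.hasSum_re h3
    convert! this using 2 with n
    rw [← Complex.ofReal_pow, ← Complex.ofReal_mul, Complex.ofReal_re]
  refine (sum_le_hasSum _ (fun n _ => mul_nonneg (truncatedCount_nonneg _ _) (by positivity))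
    h4).trans (Complex.re_le_norm _)

lemma summable_norm_overpartitionGF {q : ℂ} (hq : ‖q‖ < 1) :
    Summable fun n => ‖(overpartitionCount n : ℂ) * q ^ n‖ := by
  simpa using summable_overpartitionCount (norm_nonneg q) hq

/-- `∑ p̄(n) q^n = ∏ (1 + q^i) / (1 - q^i)` on the unit disc. -/
lemma tendsto_overpartitionProd {q : ℂ} (hq : ‖q‖ < 1) :
    Tendsto (fun N => overpartitionProd N q) atTop (𝓝 (overpartitionGF q)) := by
  have h : ∀ N, overpartitionProd N q = ∑' n, (truncatedCount N n : ℂ) * q ^ n := fun N =>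
    (hasSum_truncatedCount N hq).tsum_eq.symm
  simp only [h]
  refine tendsto_tsum_of_dominated_convergence (summable_norm_overpartitionGF hq) (fun n => ?_)
    (Eventually.of_forall fun N n => ?_)
  · refine Tendsto.mul_const _ ?_
    exact_mod_cast (Complex.continuous_ofReal.tendsto _).comp (tendsto_truncatedCount n)
  · rw [norm_mul, norm_mul]
    refine mul_le_mul_of_nonneg_right ?_ (norm_nonneg _)
    simpa [abs_of_nonneg (truncatedCount_nonneg N n)] using truncatedCount_le N n

end

section

open Filter Topology

/-! ### Gauss's theta identity -/

/-- The product `(1 - q^2)(1 - q^4)⋯(1 - q^(2m))`. -/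
noncomputable def evenProd (q : ℂ) (m : ℕ) : ℂ := ∏ i ∈ Finset.range m, (1 - (q ^ 2) ^ (i + 1))

/-- The reciprocal of `evenProd q m`, extended by `0` to negative `m`. With this convention
`evenProdInv_sub_one` holds for all integers. -/
noncomputable def evenProdInv (q : ℂ) (m : ℤ) : ℂ := if m < 0 then 0 else (evenProd q m.toNat)⁻¹

lemma norm_sq_lt_one {q : ℂ} (hq : ‖q‖ < 1) : ‖q ^ 2‖ < 1 := by
  rw [norm_pow]; exact pow_lt_one₀ (norm_nonneg _) hq (by simp)

lemma evenProd_ne_zero {q : ℂ} (hq : ‖q‖ < 1) (m : ℕ) : evenProd q m ≠ 0 :=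
  Finset.prod_ne_zero_iff.2 fun _ _ => one_sub_pow_ne_zero (norm_sq_lt_one hq) (by simp)

lemma evenProdInv_sub_one {q : ℂ} (hq : ‖q‖ < 1) (m : ℤ) :
    evenProdInv q (m - 1) = (1 - (q ^ 2) ^ m) * evenProdInv q m := by
  rcases lt_trichotomy m 0 with h | rfl | h
  · rw [evenProdInv, evenProdInv, if_pos h, if_pos (by lia), mul_zero]
  · simp [evenProdInv]
  · obtain ⟨k, rfl⟩ : ∃ k : ℕ, m = k + 1 := ⟨(m - 1).toNat, by lia⟩
    have h1 := evenProd_ne_zero hq k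
    have h2 : (1 - (q ^ 2) ^ (k + 1)) ≠ 0 := one_sub_pow_ne_zero (norm_sq_lt_one hq) (by simp)
    rw [evenProdInv, evenProdInv, if_neg (by lia), if_neg (by lia)]
    have e1 : ((k : ℤ) + 1 - 1).toNat = k := by lia
    have e2 : ((k : ℤ) + 1).toNat = k + 1 := by lia
    have e3 : (q ^ 2) ^ ((k : ℤ) + 1) = (q ^ 2) ^ (k + 1) := by exact_mod_cast rfl
    rw [e1, e2, e3, evenProd, evenProd, Finset.prod_range_succ, ← evenProd]
    field_simp

/-- The `k`-th term, up to the sign `(-1)^k`, of the finite form of Gauss's identity. -/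
noncomputable def gaussTerm (q : ℂ) (n : ℕ) (k : ℤ) : ℂ :=
  q ^ (k ^ 2) * evenProdInv q (n - k) * evenProdInv q (n + k)

/-- The `q`-Pascal recurrence for two steps at once. -/
lemma gaussTerm_succ {q : ℂ} (hq : ‖q‖ < 1) (h0 : q ≠ 0) (n : ℕ) (k : ℤ) :
    (1 - q ^ (4 * n + 2)) * (1 - q ^ (4 * n + 4)) * gaussTerm q (n + 1) k =
      (1 + q ^ (4 * n + 2)) * gaussTerm q n k +
        q ^ (2 * n + 1) * (gaussTerm q n (k - 1) + gaussTerm q n (k + 1)) := by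
  obtain ⟨a, ha⟩ : ∃ a : ℤ, a = n + 1 - k := ⟨_, rfl⟩
  obtain ⟨b, hb⟩ : ∃ b : ℤ, b = n + 1 + k := ⟨_, rfl⟩
  simp only [gaussTerm]
  rw [show ((n + 1 : ℕ) : ℤ) - k = a by push_cast; lia, show ((n + 1 : ℕ) : ℤ) + k = b by
    push_cast; lia, show (n : ℤ) - k = a - 1 by lia, show (n : ℤ) + k = b - 1 by lia,
    show (n : ℤ) - (k - 1) = a by lia, show (n : ℤ) + (k - 1) = b - 1 - 1 by lia,
    show (n : ℤ) - (k + 1) = a - 1 - 1 by lia, show (n : ℤ) + (k + 1) = b by lia]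
  rw [evenProdInv_sub_one hq (a - 1), evenProdInv_sub_one hq (b - 1), evenProdInv_sub_one hq a,
    evenProdInv_sub_one hq b]
  have h2 : q ^ 2 ≠ 0 := pow_ne_zero _ h0
  have hz : ∀ m : ℤ, (q ^ 2) ^ m = q ^ (2 * m) := fun m => by
    rw [zpow_mul]; norm_cast
  have e1 : q ^ (4 * n + 4) = (q ^ 2) ^ a * (q ^ 2) ^ b := by
    rw [hz, hz, ← zpow_add₀ h0, ← zpow_natCast]; congr 1; push_cast; lia
  have e2 : q ^ (4 * n + 2) = (q ^ 2) ^ a * (q ^ 2) ^ b * (q ^ 2)⁻¹ := by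
    rw [← e1]; field_simp; ring
  have e3 : q ^ (2 * n + 1) * q ^ ((k - 1) ^ 2) = q ^ (k ^ 2) * (q ^ 2) ^ a := by
    rw [hz, ← zpow_add₀ h0, ← zpow_natCast, ← zpow_add₀ h0]; congr 1; push_cast; rw [ha]; ring
  have e4 : q ^ (2 * n + 1) * q ^ ((k + 1) ^ 2) = q ^ (k ^ 2) * (q ^ 2) ^ b := by
    rw [hz, ← zpow_add₀ h0, ← zpow_natCast, ← zpow_add₀ h0]; congr 1; push_cast; rw [hb]; ring
  have e5 : ∀ m : ℤ, (q ^ 2) ^ (m - 1) = (q ^ 2) ^ m * (q ^ 2)⁻¹ := fun m => by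
    rw [zpow_sub₀ h2, zpow_one]; rfl
  rw [e1, e2, e5, e5]
  linear_combination
    -evenProdInv q a * (1 - (q ^ 2) ^ b * (q ^ 2)⁻¹) * (1 - (q ^ 2) ^ b) * evenProdInv q b * e3
    - evenProdInv q a * (1 - (q ^ 2) ^ a * (q ^ 2)⁻¹) * (1 - (q ^ 2) ^ a) * evenProdInv q b * e4

lemma gaussTerm_zero {q : ℂ} (k : ℤ) : gaussTerm q 0 k = if k = 0 then 1 else 0 := by
  rcases lt_trichotomy k 0 with h | rfl | h
  · simp [gaussTerm, evenProdInv, h, h.ne]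
  · simp [gaussTerm, evenProdInv, evenProd]
  · simp [gaussTerm, evenProdInv, h, h.ne']

/-- Finite form of Gauss's identity, the case `z = -1` of the finite Jacobi triple product. -/
lemma hasSum_gaussTerm {q : ℂ} (hq : ‖q‖ < 1) (h0 : q ≠ 0) (n : ℕ) :
    HasSum (fun k : ℤ => (-1) ^ k * gaussTerm q n k)
      (∏ i ∈ Finset.range n, (1 - q ^ (2 * i + 1)) / ((1 + q ^ (2 * i + 1)) *
        (1 - q ^ (4 * i + 4)))) := by
  induction n with
  | zero =>
    convert! hasSum_ite_eq (0 : ℤ) (1 : ℂ) using 2 with k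
    rw [gaussTerm_zero]
    split_ifs with h <;> simp [h]
  | succ n ih =>
    have a1 : 1 - q ^ (4 * n + 2) ≠ 0 := one_sub_pow_ne_zero hq (by simp)
    have a2 : 1 - q ^ (4 * n + 4) ≠ 0 := one_sub_pow_ne_zero hq (by simp)
    have a3 : 1 + q ^ (2 * n + 1) ≠ 0 := one_add_pow_ne_zero hq (by simp)
    have h1 := (Equiv.subRight (1 : ℤ)).hasSum_iff.2 ih
    have h2 := (Equiv.addRight (1 : ℤ)).hasSum_iff.2 ih
    have h3 := ((ih.mul_left (1 + q ^ (4 * n + 2))).sub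
      ((h1.add h2).mul_left (q ^ (2 * n + 1)))).div_const
        ((1 - q ^ (4 * n + 2)) * (1 - q ^ (4 * n + 4)))
    rw [Finset.prod_range_succ]
    convert! h3 using 1
    · ext k
      rw [eq_div_iff (mul_ne_zero a1 a2)]
      have := gaussTerm_succ hq h0 n k
      have s1 : (-1 : ℂ) ^ (k - 1) = -(-1) ^ k := by
        rw [zpow_sub₀ (by norm_num), zpow_one, div_neg, div_one]
      have s2 : (-1 : ℂ) ^ (k + 1) = -(-1) ^ k := by
        rw [zpow_add₀ (by norm_num), zpow_one, mul_neg, mul_one]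
      simp only [Function.comp, Equiv.subRight_apply, Equiv.coe_addRight, s1, s2]
      linear_combination (-1) ^ k * this
    · have e : 1 - q ^ (4 * n + 2) = (1 - q ^ (2 * n + 1)) * (1 + q ^ (2 * n + 1)) := by ring
      have a4 : 1 - q ^ (2 * n + 1) ≠ 0 := one_sub_pow_ne_zero hq (by simp)
      rw [e]
      field_simp
      ring

lemma overpartitionProd_mul_evenProd {q : ℂ} (hq : ‖q‖ < 1) (n : ℕ) :
    evenProd q n ^ 2 * (∏ i ∈ Finset.range n, (1 - q ^ (2 * i + 1)) / ((1 + q ^ (2 * i + 1)) *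
        (1 - q ^ (4 * i + 4)))) * overpartitionProd (2 * n) q = 1 := by
  induction n with
  | zero => simp [evenProd, overpartitionProd]
  | succ n ih =>
    have a1 : 1 + q ^ (2 * n + 1) ≠ 0 := one_add_pow_ne_zero hq (by simp)
    have a2 : 1 - q ^ (2 * n + 1) ≠ 0 := one_sub_pow_ne_zero hq (by simp)
    have a3 : 1 - q ^ (2 * n + 2) ≠ 0 := one_sub_pow_ne_zero hq (by simp)
    have a4 : 1 + q ^ (2 * n + 2) ≠ 0 := one_add_pow_ne_zero hq (by simp)
    have e : 1 - q ^ (4 * n + 4) = (1 - q ^ (2 * n + 2)) * (1 + q ^ (2 * n + 2)) := by ring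
    have e2 : (q ^ 2) ^ (n + 1) = q ^ (2 * n + 2) := by rw [← pow_mul]; ring
    have e3 : overpartitionProd (2 * (n + 1)) q = overpartitionProd (2 * n) q *
        ((1 + q ^ (2 * n + 1)) / (1 - q ^ (2 * n + 1))) *
        ((1 + q ^ (2 * n + 2)) / (1 - q ^ (2 * n + 2))) := by
      rw [overpartitionProd, show 2 * (n + 1) = 2 * n + 1 + 1 by ring, Finset.prod_range_succ,
        Finset.prod_range_succ, ← overpartitionProd]
    have e4 : evenProd q (n + 1) = evenProd q n * (1 - q ^ (2 * n + 2)) := by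
      rw [evenProd, Finset.prod_range_succ, ← evenProd, e2]
    rw [Finset.prod_range_succ, e3, e4, e]
    refine Eq.trans ?_ ih
    field_simp

lemma summable_pow_natAbs_sq {r : ℝ} (h0 : 0 ≤ r) (h1 : r < 1) :
    Summable fun k : ℤ => r ^ (k.natAbs ^ 2) := by
  have h : Summable fun n : ℕ => r ^ (n ^ 2) :=
    (summable_geometric_of_lt_one h0 h1).of_nonneg_of_le (fun n => by positivity) fun n =>
      pow_le_pow_of_le_one h0 h1.le (Nat.le_self_pow (by norm_num) n)
  exact Summable.of_nat_of_neg (by simpa using h) (by simpa using h)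

/-- Gauss's identity `(∑ p̄(n) q^n) (∑ (-1)^k q^(k^2)) = 1`: the limit `n → ∞` of the finite
form. -/
theorem overpartitionGF_mul_theta {q : ℂ} (hq : ‖q‖ < 1) (h0 : q ≠ 0) :
    overpartitionGF q * ∑' k : ℤ, (-1) ^ k * q ^ (k.natAbs ^ 2) = 1 := by
  obtain ⟨L, hL, hLt⟩ := exists_tendsto_prod_one_sub (norm_sq_lt_one hq)
  change Tendsto (fun n => evenProd q n) atTop (𝓝 L) at hLt
  obtain ⟨C, hC⟩ := (Metric.isBounded_range_of_tendsto _ hLt).exists_norm_le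
  obtain ⟨D, hD⟩ := (Metric.isBounded_range_of_tendsto _ (hLt.inv₀ hL)).exists_norm_le
  have hC' : ∀ n, ‖evenProd q n‖ ≤ C := fun n => hC _ ⟨n, rfl⟩
  have hC0 : 0 ≤ C := (norm_nonneg _).trans (hC' 0)
  have hD' : ∀ n, ‖(evenProd q n)⁻¹‖ ≤ D := fun n => hD _ ⟨n, rfl⟩
  have hD0 : 0 ≤ D := (norm_nonneg _).trans (hD' 0)
  have hR : ∀ m, ‖evenProdInv q m‖ ≤ D := by
    intro m
    rw [evenProdInv]
    split_ifs
    · simpa using hD0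
    · exact hD' _
  have hRt : ∀ f : ℕ → ℕ, ∀ g : ℕ → ℤ, Tendsto f atTop atTop → (∀ᶠ n in atTop, g n = f n) →
      Tendsto (fun n => evenProdInv q (g n)) atTop (𝓝 L⁻¹) := by
    intro f g hf hg
    refine ((hLt.inv₀ hL).comp hf).congr' ?_
    filter_upwards [hg] with n hn
    rw [hn, evenProdInv, if_neg (by lia)]
    simp
  have hzp : ∀ k : ℤ, q ^ (k ^ 2) = q ^ (k.natAbs ^ 2) := fun k => by
    rw [← Int.natAbs_sq, ← zpow_natCast]; push_cast; rfl
  have T1 : Tendsto (fun n : ℕ => ∑' k : ℤ, evenProd q n ^ 2 * ((-1) ^ k * gaussTerm q n k)) atTop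
      (𝓝 (∑' k : ℤ, (-1) ^ k * q ^ (k.natAbs ^ 2))) := by
    refine tendsto_tsum_of_dominated_convergence
      (bound := fun k : ℤ => C ^ 2 * (‖q‖ ^ (k.natAbs ^ 2) * D * D))
      ((((summable_pow_natAbs_sq (norm_nonneg q) hq).mul_right D).mul_right D).mul_left _)
      (fun k => ?_) (Eventually.of_forall fun n k => ?_)
    · have r1 := hRt (fun n => ((n : ℤ) - k).toNat) (fun n => n - k)
        (tendsto_atTop.2 fun b => by
          filter_upwards [eventually_ge_atTop (b + k.natAbs)] with n hn; lia)
        (by filter_upwards [eventually_ge_atTop (k.natAbs)] with n hn; lia)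
      have r2 := hRt (fun n => ((n : ℤ) + k).toNat) (fun n => n + k)
        (tendsto_atTop.2 fun b => by
          filter_upwards [eventually_ge_atTop (b + k.natAbs)] with n hn; lia)
        (by filter_upwards [eventually_ge_atTop (k.natAbs)] with n hn; lia)
      have := (hLt.pow 2).mul (((r1.const_mul (q ^ (k ^ 2))).mul r2).const_mul ((-1) ^ k))
      convert! this using 2
      rw [hzp]; field_simp
    · have s : ‖(-1 : ℂ) ^ k‖ = 1 := by rw [norm_zpow]; simp
      rw [norm_mul, norm_mul, s, one_mul, gaussTerm, norm_mul, norm_mul, norm_pow, hzp, norm_pow]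
      have := hR (n - k)
      have := hR (n + k)
      have := hC' n
      gcongr
  have T2 : Tendsto (fun n : ℕ => overpartitionProd (2 * n) q) atTop (𝓝 (overpartitionGF q)) :=
    (tendsto_overpartitionProd hq).comp (tendsto_id.const_mul_atTop' (by norm_num))
  refine tendsto_nhds_unique (T2.mul T1) ?_
  refine tendsto_const_nhds.congr fun n => ?_
  rw [tsum_mul_left, (hasSum_gaussTerm hq h0 n).tsum_eq, mul_comm,
    overpartitionProd_mul_evenProd hq]

end

section

open Filter Topology MeasureTheory

/-! ### Coefficient extraction and the square recurrence -/

lemma integral_cexp_int_mul (m : ℤ) :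
    ∫ θ in (-Real.pi)..Real.pi, Complex.exp (m * (θ * Complex.I)) =
      if m = 0 then (2 * Real.pi : ℂ) else 0 := by
  split_ifs with h
  · simp [h]; ring
  · have hm : (m : ℂ) * Complex.I ≠ 0 := by simp [h]
    have := integral_exp_mul_complex (a := -Real.pi) (b := Real.pi) hm
    have e : ∀ θ : ℝ, (m : ℂ) * (θ * Complex.I) = m * Complex.I * θ := fun θ => by ring
    simp only [e]
    rw [this]
    have e2 : (m : ℂ) * Complex.I * (Real.pi : ℝ) =
        m * Complex.I * (-Real.pi : ℝ) + m * (2 * Real.pi * Complex.I) := by push_cast; ring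
    rw [e2, Complex.exp_add, Complex.exp_int_mul_two_pi_mul_I]
    simp

/-- Cauchy's coefficient formula on the circle `|q| = exp (-y)`, in the variable `z = y + θ i` with
`q = exp (-z)`. -/
lemma integral_powerSeries_mul_cexp {c : ℕ → ℂ} {y : ℝ}
    (hc : Summable fun k => ‖c k‖ * Real.exp (-y) ^ k) (n : ℕ) :
    ∫ θ in (-Real.pi)..Real.pi, (∑' k, c k * Complex.exp (-(y + θ * Complex.I)) ^ k) *
      Complex.exp (n * (y + θ * Complex.I)) = 2 * Real.pi * c n := by
  have e : ∀ (k : ℕ) (θ : ℝ), c k * Complex.exp (-(y + θ * Complex.I)) ^ k *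
      Complex.exp (n * (y + θ * Complex.I)) = c k * Complex.exp (((n : ℤ) - k : ℤ) * y) *
        Complex.exp (((n : ℤ) - k : ℤ) * (θ * Complex.I)) := fun k θ => by
    rw [← Complex.exp_nat_mul, mul_assoc, mul_assoc, ← Complex.exp_add, ← Complex.exp_add]
    push_cast; ring_nf
  have h1 := intervalIntegral.hasSum_integral_of_dominated_convergence
    (μ := volume) (a := -Real.pi) (b := Real.pi)
    (F := fun (k : ℕ) (θ : ℝ) => c k * Complex.exp (-(y + θ * Complex.I)) ^ k *
      Complex.exp (n * (y + θ * Complex.I)))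
    (f := fun θ : ℝ => (∑' k, c k * Complex.exp (-(y + θ * Complex.I)) ^ k) *
      Complex.exp (n * (y + θ * Complex.I)))
    (fun k _ => ‖c k‖ * Real.exp (-y) ^ k * Real.exp (n * y))
    (fun k => (by fun_prop : Continuous _).aestronglyMeasurable)
    (fun k => Eventually.of_forall fun θ _ => by
      rw [norm_mul, norm_mul, norm_pow, Complex.norm_exp, Complex.norm_exp]
      simp)
    (Eventually.of_forall fun θ _ => hc.mul_right _)
    (by simp)
    (Eventually.of_forall fun θ _ => by
      refine HasSum.mul_right _ (Summable.hasSum ?_)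
      refine Summable.of_norm ?_
      refine hc.congr fun k => ?_
      rw [norm_mul, norm_pow, Complex.norm_exp]
      simp)
  have h2 : ∀ k : ℕ, ∫ θ in (-Real.pi)..Real.pi, c k * Complex.exp (-(y + θ * Complex.I)) ^ k *
      Complex.exp (n * (y + θ * Complex.I)) = if k = n then 2 * Real.pi * c n else 0 := by
    intro k
    simp only [e]
    rw [intervalIntegral.integral_const_mul, integral_cexp_int_mul]
    by_cases h : k = n
    · subst h; simp; ring
    · rw [if_neg h, if_neg (by lia), mul_zero]
  simp only [h2] at h1
  exact h1.unique (hasSum_ite_eq n _)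

/-- The coefficients of `∑ (-1)^k q^(k^2)`, the sum over all integers `k`. -/
noncomputable def thetaCoeff (m : ℕ) : ℝ :=
  if m = 0 then 1 else if Nat.sqrt m ^ 2 = m then 2 * (-1) ^ Nat.sqrt m else 0

lemma thetaCoeff_sq (k : ℕ) : thetaCoeff ((k + 1) ^ 2) = 2 * (-1) ^ (k + 1) := by
  rw [thetaCoeff, if_neg (by positivity), Nat.sqrt_eq', if_pos rfl]

lemma neg_one_zpow_eq_pow_natAbs (k : ℤ) : (-1 : ℂ) ^ k = (-1) ^ k.natAbs := by
  rcases Int.natAbs_eq k with h | h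
  · conv_lhs => rw [h]
    exact zpow_natCast _ _
  · conv_lhs => rw [h]
    rw [zpow_neg, ← inv_zpow, zpow_natCast]
    norm_num

lemma hasSum_thetaCoeff {q : ℂ} (hq : ‖q‖ < 1) :
    HasSum (fun m : ℕ => (thetaCoeff m : ℂ) * q ^ m) (∑' k : ℤ, (-1) ^ k * q ^ (k.natAbs ^ 2)) := by
  have hs : Summable fun k : ℤ => (-1) ^ k * q ^ (k.natAbs ^ 2) := by
    refine Summable.of_norm ((summable_pow_natAbs_sq (norm_nonneg q) hq).congr fun k => ?_)
    rw [norm_mul, norm_zpow, norm_neg, norm_one, one_zpow, one_mul, norm_pow]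
  have hn1 : ∀ k : ℕ, ((k : ℤ) + 1).natAbs = k + 1 := fun k => by lia
  have hn2 : ∀ k : ℕ, (-((k : ℤ) + 1)).natAbs = k + 1 := fun k => by lia
  simp only [neg_one_zpow_eq_pow_natAbs] at hs ⊢
  have hs' : Summable fun k : ℕ => (-1 : ℂ) ^ (k + 1) * q ^ ((k + 1) ^ 2) := by
    have := hs.comp_injective (i := fun k : ℕ => (k : ℤ) + 1) (fun a b h => by simpa using h)
    refine this.congr fun k => ?_
    simp only [Function.comp, hn1]
  have h1 : HasSum (fun k : ℤ => (-1 : ℂ) ^ k.natAbs * q ^ (k.natAbs ^ 2))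
      (1 + ∑' k : ℕ, (-1 : ℂ) ^ (k + 1) * q ^ ((k + 1) ^ 2) +
        ∑' k : ℕ, (-1 : ℂ) ^ (k + 1) * q ^ ((k + 1) ^ 2)) := by
    refine HasSum.of_nat_of_neg_add_one ?_ ?_
    · rw [add_comm, ← hasSum_nat_add_iff' 1]
      simp only [Finset.range_one, Finset.sum_singleton, Nat.cast_zero, Int.natAbs_zero, pow_zero,
        Nat.cast_add, Nat.cast_one, hn1, ne_eq, OfNat.ofNat_ne_zero, not_false_eq_true, zero_pow,
        mul_one, add_sub_cancel_right]
      exact hs'.hasSum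
    · simp only [hn2]
      exact hs'.hasSum
  rw [h1.tsum_eq]
  have hinj : Function.Injective fun k : ℕ => (k + 1) ^ 2 - 1 := by
    intro a b h
    have h' : (a + 1) ^ 2 - 1 = (b + 1) ^ 2 - 1 := h
    have ha : 1 ≤ (a + 1) ^ 2 := Nat.one_le_pow _ _ (by simp)
    have hb : 1 ≤ (b + 1) ^ 2 := Nat.one_le_pow _ _ (by simp)
    have : (a + 1) ^ 2 = (b + 1) ^ 2 := by lia
    have := Nat.pow_left_injective (n := 2) (by norm_num) this
    lia
  rw [add_assoc, ← two_mul, add_comm, ← hasSum_nat_add_iff' 1]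
  simp only [Finset.range_one, Finset.sum_singleton, pow_zero, mul_one]
  have h0 : (thetaCoeff 0 : ℂ) = 1 := by simp [thetaCoeff]
  rw [h0, add_sub_cancel_right, ← hinj.hasSum_iff]
  · refine (hs'.hasSum.mul_left 2).congr_fun fun k => ?_
    have ha : (k + 1) ^ 2 - 1 + 1 = (k + 1) ^ 2 := Nat.sub_add_cancel (Nat.one_le_pow _ _ (by simp))
    simp only [Function.comp, ha, thetaCoeff_sq]
    push_cast; ring
  · intro m hm
    have : ¬ (Nat.sqrt (m + 1) ^ 2 = m + 1) := by
      intro h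
      have h1 : Nat.sqrt (m + 1) ≠ 0 := by rintro h'; rw [h'] at h; simp at h
      refine hm ⟨Nat.sqrt (m + 1) - 1, ?_⟩
      simp only
      rw [Nat.sub_add_cancel (Nat.one_le_iff_ne_zero.2 h1), h, Nat.add_sub_cancel]
    simp [thetaCoeff, this]

/-- The recurrence `∑ (-1)^k p̄(n - k^2) = 0` for `n > 0`, in convolution form. -/
lemma sum_overpartitionCount_mul_thetaCoeff {n : ℕ} (hn : n ≠ 0) :
    ∑ x ∈ Finset.HasAntidiagonal.antidiagonal n, (overpartitionCount x.1 : ℝ) * thetaCoeff x.2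
      = 0 := by
  let φ : PowerSeries ℝ := PowerSeries.mk fun n => (overpartitionCount n : ℝ)
  let ψ : PowerSeries ℝ := PowerSeries.mk thetaCoeff
  have key : ∀ q : ℂ, ‖q‖ < 1 → q ≠ 0 →
      HasSum (fun n => ((φ * ψ).coeff n : ℂ) * q ^ n) 1 := by
    intro q hq h0
    rw [← overpartitionGF_mul_theta hq h0]
    refine hasSum_coeff_mul ?_ ?_
    · simp only [φ, PowerSeries.coeff_mk, Complex.ofReal_natCast]
      exact (summable_norm_overpartitionGF hq).of_norm.hasSum
    · simpa [ψ] using hasSum_thetaCoeff hq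
  have hE : ∀ θ : ℝ, ‖Complex.exp (-((1 : ℝ) + θ * Complex.I))‖ = Real.exp (-1) := fun θ => by
    rw [Complex.norm_exp]; simp
  have hlt : ∀ θ : ℝ, ‖Complex.exp (-((1 : ℝ) + θ * Complex.I))‖ < 1 := fun θ => by
    rw [hE]; simp
  have h1 := integral_powerSeries_mul_cexp (c := fun n => ((φ * ψ).coeff n : ℂ)) (y := 1) (by
    have := (key _ (hlt 0) (Complex.exp_ne_zero _)).summable.norm
    refine this.congr fun k => ?_
    rw [norm_mul, norm_pow, hE]) n
  have h2 := fun θ : ℝ => (key _ (hlt θ) (Complex.exp_ne_zero _)).tsum_eq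
  simp only [h2, one_mul] at h1
  have e : ∀ θ : ℝ, Complex.exp (n * ((1 : ℝ) + θ * Complex.I)) =
      Complex.exp n * Complex.exp ((n : ℤ) * (θ * Complex.I)) := fun θ => by
    rw [← Complex.exp_add]; push_cast; ring_nf
  simp only [e] at h1
  rw [intervalIntegral.integral_const_mul, integral_cexp_int_mul, if_neg (by exact_mod_cast hn),
    mul_zero] at h1
  have h3 : ((φ * ψ).coeff n : ℂ) = 0 := by
    have hp : (2 * Real.pi : ℂ) ≠ 0 := by exact_mod_cast Real.two_pi_pos.ne'
    exact (mul_eq_zero.1 h1.symm).resolve_left hp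
  have h4 : (φ * ψ).coeff n = 0 := by exact_mod_cast h3
  rw [PowerSeries.coeff_mul] at h4
  simpa [φ, ψ] using h4

lemma overpartitionCount_zero : overpartitionCount 0 = 1 := by
  rw [overpartitionCount_eq_sum]
  rfl

/-! ### Evaluating the recurrence -/

/-- The alternating sum of the entries of a list at the positions `c + k g + k^2`, `k = 0, 1, …`.
For `c = 0`, `g = 2` these are the positions `(k + 1)^2 - 1`. -/
def altSquareSum : List ℕ → ℕ → ℕ → ℤ
  | [], _, _ => 0
  | x :: xs, 0, g => x - altSquareSum xs g (g + 2)
  | _ :: xs, c + 1, g => altSquareSum xs c g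

lemma altSquareSum_eq (l : List ℕ) (c g K : ℕ) (hK : l.length ≤ K) :
    altSquareSum l c g = ∑ k ∈ Finset.range K, (-1) ^ k * (l.getD (c + k * g + k ^ 2) 0 : ℤ) := by
  induction l generalizing c g K with
  | nil => simp [altSquareSum]
  | cons x xs ih =>
    obtain ⟨K, rfl⟩ : ∃ m, K = m + 1 := Nat.exists_eq_succ_of_ne_zero (by rintro rfl; simp at hK)
    simp only [List.length_cons, add_le_add_iff_right] at hK
    cases c with
    | zero =>
      rw [altSquareSum, ih g (g + 2) K hK, Finset.sum_range_succ']
      have e : ∀ k, 0 + (k + 1) * g + (k + 1) ^ 2 = (g + k * (g + 2) + k ^ 2) + 1 := fun k => by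
        ring
      simp only [e, List.getD_cons_succ, pow_succ (-1 : ℤ)]
      simp
      ring
    | succ c =>
      rw [altSquareSum, ih c g (K + 1) (by lia)]
      refine Finset.sum_congr rfl fun k _ => ?_
      rw [show c + 1 + k * g + k ^ 2 = (c + k * g + k ^ 2) + 1 by ring, List.getD_cons_succ]

/-- The list `[p̄(n - 1), …, p̄(0)]`. -/
def overpartitionList : ℕ → List ℕ
  | 0 => []
  | n + 1 => overpartitionCount n :: overpartitionList n

lemma length_overpartitionList (n : ℕ) : (overpartitionList n).length = n := by
  induction n with
  | zero => rfl
  | succ n ih => simp [overpartitionList, ih]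

lemma getD_overpartitionList (n j : ℕ) :
    (overpartitionList n).getD j 0 = if j < n then overpartitionCount (n - 1 - j) else 0 := by
  induction n generalizing j with
  | zero => simp [overpartitionList]
  | succ n ih =>
    cases j with
    | zero => simp [overpartitionList]
    | succ j =>
      rw [overpartitionList, List.getD_cons_succ, ih]
      simp only [add_lt_add_iff_right, Nat.add_sub_cancel]
      rw [show n - 1 - j = n - (j + 1) by lia]

/-- The recurrence `p̄(n) = 2 (p̄(n - 1) - p̄(n - 4) + p̄(n - 9) - ⋯)`. -/
lemma overpartitionCount_eq_altSquareSum {n : ℕ} (hn : n ≠ 0) :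
    (overpartitionCount n : ℤ) = 2 * altSquareSum (overpartitionList n) 0 2 := by
  have h := sum_overpartitionCount_mul_thetaCoeff hn
  rw [← Finset.Nat.sum_antidiagonal_swap, Finset.Nat.sum_antidiagonal_eq_sum_range_succ_mk,
    Finset.sum_range_succ'] at h
  simp only [Prod.fst_swap, Prod.snd_swap, Nat.sub_zero] at h
  have h0 : thetaCoeff 0 = 1 := by simp [thetaCoeff]
  rw [h0, mul_one] at h
  have h2 : ∑ j ∈ Finset.range n, (overpartitionCount (n - (j + 1)) : ℝ) * thetaCoeff (j + 1) =
      ∑ k ∈ Finset.range n, 2 * (-1) ^ (k + 1) *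
        ((overpartitionList n).getD (0 + k * 2 + k ^ 2) 0 : ℝ) := by
    symm
    have hinj : Set.InjOn (fun k : ℕ => k * 2 + k ^ 2) (Finset.range n) := by
      intro a _ b _ hab
      have hab' : a * 2 + a ^ 2 = b * 2 + b ^ 2 := hab
      have : (a + 1) ^ 2 = (b + 1) ^ 2 := by linarith
      have := Nat.pow_left_injective (n := 2) (by norm_num) this
      lia
    have hz : ∀ j, ¬ j < n → ((overpartitionList n).getD j 0 : ℝ) = 0 := fun j hj => by
      rw [getD_overpartitionList, if_neg hj, Nat.cast_zero]
    rw [← Finset.sum_filter_of_ne (p := fun k => k * 2 + k ^ 2 < n)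
      (fun k _ hk => by_contra fun hk' => hk (by rw [zero_add, hz _ hk', mul_zero]))]
    refine Finset.sum_of_injOn (fun k : ℕ => k * 2 + k ^ 2)
      (hinj.mono (by simp only [Finset.coe_filter]; intro x hx; exact Finset.mem_coe.2 hx.1))
      (fun k hk => ?_) (fun j hj hj' => ?_) (fun k hk => ?_)
    · simpa using (Finset.mem_filter.1 hk).2
    · have : ¬ (Nat.sqrt (j + 1) ^ 2 = j + 1) := by
        intro h
        have h1 : Nat.sqrt (j + 1) ≠ 0 := by rintro h'; rw [h'] at h; simp at h
        obtain ⟨s, hs⟩ := Nat.exists_eq_succ_of_ne_zero h1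
        rw [hs] at h
        have h3 : s * 2 + s ^ 2 = j := by
          have : (s + 1) ^ 2 = j + 1 := h
          linarith
        have hjn := Finset.mem_range.1 hj
        refine hj' ⟨s, ?_, h3⟩
        simp only [Finset.coe_filter, Finset.mem_range, Set.mem_ofPred_eq]
        exact ⟨by nlinarith, by lia⟩
      simp [thetaCoeff, this]
    · have hk' := (Finset.mem_filter.1 hk).2
      simp only [zero_add]
      rw [getD_overpartitionList, if_pos hk', show k * 2 + k ^ 2 + 1 = (k + 1) ^ 2 by ring,
        thetaCoeff_sq, show n - 1 - (k * 2 + k ^ 2) = n - (k + 1) ^ 2 by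
          rw [show (k + 1) ^ 2 = 1 + (k * 2 + k ^ 2) by ring]; lia]
      ring
  rw [h2] at h
  have h3 : (overpartitionCount n : ℝ) = 2 * (altSquareSum (overpartitionList n) 0 2 : ℝ) := by
    rw [altSquareSum_eq _ 0 2 n (length_overpartitionList n).le]
    push_cast
    rw [Finset.mul_sum]
    have : ∀ k ∈ Finset.range n, 2 * (-1) ^ (k + 1) *
        ((overpartitionList n).getD (0 + k * 2 + k ^ 2) 0 : ℝ) = -(2 * ((-1) ^ k *
        ((overpartitionList n).getD (0 + k * 2 + k ^ 2) 0 : ℝ))) := fun k _ => by ring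
    rw [Finset.sum_congr rfl this, Finset.sum_neg_distrib] at h
    linarith
  exact_mod_cast h3

/-- Case analysis on a natural number. In kernel reduction it evaluates the argument to a numeral
before passing it on, so that entries of a list are computed only once. -/
def evalThen {α : Type} (k : ℕ → α) : ℕ → α
  | 0 => k 0
  | n + 1 => k (n + 1)

lemma evalThen_eq {α : Type} (k : ℕ → α) (n : ℕ) : evalThen k n = k n := by
  cases n <;> rfl

/-- Extends the list `l = [p̄(n - 1), …, p̄(0)]` by `m` further values, checking strict
log-concavity at each step. -/
def checkLogConcave : ℕ → List ℕ → Bool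
  | 0, _ => true
  | m + 1, l => evalThen (fun x => match l with
      | b :: a :: _ => bif Nat.blt (a * x) (b * b) then checkLogConcave m (x :: l) else false
      | _ => false) (2 * altSquareSum l 0 2).toNat

lemma checkLogConcave_spec (m n : ℕ) (h : checkLogConcave m (overpartitionList (n + 2)) = true)
    (k : ℕ) (hk : n ≤ k) (hkm : k < n + m) :
    overpartitionCount k * overpartitionCount (k + 2) < overpartitionCount (k + 1) ^ 2 := by
  induction m generalizing n with
  | zero => lia
  | succ m ih =>
    rw [checkLogConcave, evalThen_eq, ← overpartitionCount_eq_altSquareSum (by lia),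
      Int.toNat_natCast] at h
    have e : overpartitionList (n + 2) =
      overpartitionCount (n + 1) :: overpartitionCount n :: overpartitionList n := rfl
    rw [e] at h
    simp only [Bool.cond_eq_ite, Bool.if_false_right, Bool.and_eq_true, decide_eq_true_eq] at h
    rcases hk.eq_or_lt with rfl | hk
    · have := h.1
      rw [Nat.blt_eq] at this
      rwa [sq]
    · exact ih (n + 1) (by simpa [overpartitionList] using h.2) hk (by lia)

lemma overpartitionList_four : overpartitionList 4 = [8, 4, 2, 1] := by
  have h0 := overpartitionCount_zero
  have h1 := overpartitionCount_eq_altSquareSum (n := 1) (by norm_num)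
  simp [overpartitionList, altSquareSum, h0] at h1
  have h1' : overpartitionCount 1 = 2 := by exact_mod_cast h1
  have h2 := overpartitionCount_eq_altSquareSum (n := 2) (by norm_num)
  simp [overpartitionList, altSquareSum, h0, h1'] at h2
  have h2' : overpartitionCount 2 = 4 := by exact_mod_cast h2
  have h3 := overpartitionCount_eq_altSquareSum (n := 3) (by norm_num)
  simp [overpartitionList, altSquareSum, h0, h1', h2'] at h3
  have h3' : overpartitionCount 3 = 8 := by exact_mod_cast h3
  simp [overpartitionList, h0, h1', h2', h3']

lemma logConcave_of_lt {k : ℕ} (h2 : 2 ≤ k) (hk : k < 640) :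
    overpartitionCount k * overpartitionCount (k + 2) < overpartitionCount (k + 1) ^ 2 := by
  refine checkLogConcave_spec 638 2 ?_ k h2 (by lia)
  rw [overpartitionList_four]
  decide +kernel

end

section

open Filter Topology MeasureTheory

/-! ### Behaviour of the generating function near `q = 1` -/

/-- The leading term `(1/2) √(z/π) exp(π²/(4z))` of `∑ p̄(n) exp(-nz)` as `z → 0`. -/
noncomputable def mainTerm (z : ℂ) : ℂ :=
  1 / 2 * (z / Real.pi) ^ (1 / 2 : ℂ) * Complex.exp (Real.pi ^ 2 / (4 * z))

lemma ne_zero_of_re_pos {z : ℂ} (hz : 0 < z.re) : z ≠ 0 := by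
  rintro rfl; simp at hz

lemma norm_exp_neg_lt_one {z : ℂ} (hz : 0 < z.re) : ‖Complex.exp (-z)‖ < 1 := by
  rw [Complex.norm_exp]; simpa using hz

lemma tsum_eq_jacobiTheta₂ (z : ℂ) :
    ∑' k : ℤ, (-1) ^ k * Complex.exp (-z) ^ (k.natAbs ^ 2) =
      jacobiTheta₂ (1 / 2) (Complex.I * z / Real.pi) := by
  rw [jacobiTheta₂]
  refine tsum_congr fun k => ?_
  have hpi : (Real.pi : ℂ) ≠ 0 := by exact_mod_cast Real.pi_ne_zero
  have h1 : (-1 : ℂ) ^ k = Complex.exp (2 * Real.pi * Complex.I * k * (1 / 2)) := by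
    rw [← Complex.exp_pi_mul_I, ← Complex.exp_int_mul]; ring_nf
  have h2 : ((k.natAbs ^ 2 : ℕ) : ℂ) = (k : ℂ) ^ 2 := by
    have : ((k.natAbs ^ 2 : ℕ) : ℤ) = k ^ 2 := by push_cast; exact sq_abs k
    rw [← Int.cast_natCast, this, Int.cast_pow]
  rw [jacobiTheta₂_term, h1, ← Complex.exp_nat_mul, h2, ← Complex.exp_add]
  congr 1
  field_simp
  linear_combination -(k : ℂ) ^ 2 * z * Complex.I_sq

lemma re_inv_pos {z : ℂ} (hz : 0 < z.re) : 0 < (1 / z).re := by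
  rw [one_div, Complex.inv_re]
  exact div_pos hz (Complex.normSq_pos.2 (ne_zero_of_re_pos hz))

lemma norm_exp_neg_sq_div (z : ℂ) (m : ℕ) :
    ‖Complex.exp (-(Real.pi ^ 2 / z * m))‖ = Real.exp (-Real.pi ^ 2 * (1 / z).re * m) := by
  rw [Complex.norm_exp]
  congr 1
  have : -((Real.pi : ℂ) ^ 2 / z * m) = ((-Real.pi ^ 2 * m : ℝ) : ℂ) * (1 / z) := by
    push_cast; ring
  rw [this, Complex.re_ofReal_mul]; ring

/-- The transformed theta function is `2 (1 + w + w^3 + w^6 + ⋯)` with `w = exp(-2π²/z)`. -/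
lemma norm_jacobiTheta₂_sub_two_le {z : ℂ} (hz : 0 < z.re)
    (hw : Real.exp (-2 * Real.pi ^ 2 * (1 / z).re) ≤ 1 / 3) :
    ‖jacobiTheta₂ (1 / 2 / (Complex.I * z / Real.pi)) (-1 / (Complex.I * z / Real.pi)) - 2‖ ≤
      3 * Real.exp (-2 * Real.pi ^ 2 * (1 / z).re) := by
  set W := Real.exp (-2 * Real.pi ^ 2 * (1 / z).re) with hW
  have hz0 := ne_zero_of_re_pos hz
  have hpi : (Real.pi : ℂ) ≠ 0 := by exact_mod_cast Real.pi_ne_zero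
  have hW0 : 0 < W := Real.exp_pos _
  let f : ℕ → ℂ := fun n => Complex.exp (-(Real.pi ^ 2 / z * ((n + 1) * (n + 2) : ℕ)))
  have hf : ∀ n, ‖f n‖ ≤ W * W ^ n := fun n => by
    rw [norm_exp_neg_sq_div, ← pow_succ', hW, ← Real.exp_nat_mul]
    refine Real.exp_le_exp.2 ?_
    have := re_inv_pos hz
    have h1 : (0 : ℝ) ≤ Real.pi ^ 2 * (1 / z).re * ((n + 1) * n) := by positivity
    push_cast
    nlinarith
  have hg : HasSum (fun n => W * W ^ n) (W * (1 - W)⁻¹) :=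
    (hasSum_geometric_of_lt_one hW0.le (by linarith)).mul_left W
  have hfs : Summable f := Summable.of_norm_bounded hg.summable hf
  have hfn : ‖∑' n, f n‖ ≤ W * (1 - W)⁻¹ := tsum_of_norm_bounded hg hf
  have hterm : ∀ k : ℤ, jacobiTheta₂_term k (1 / 2 / (Complex.I * z / Real.pi))
      (-1 / (Complex.I * z / Real.pi)) = Complex.exp (-(Real.pi ^ 2 / z * (k * (k - 1)))) := by
    intro k
    rw [jacobiTheta₂_term]
    congr 1
    have hI := Complex.I_ne_zero
    field_simp
    ring
  have hsum : HasSum (fun k : ℤ => jacobiTheta₂_term k (1 / 2 / (Complex.I * z / Real.pi))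
      (-1 / (Complex.I * z / Real.pi))) ((2 + ∑' n, f n) + ∑' n, f n) := by
    simp only [hterm]
    refine HasSum.of_nat_of_neg_add_one ?_ ?_
    · rw [add_comm, ← hasSum_nat_add_iff' 2]
      convert! hfs.hasSum using 1
      · ext n
        simp only [f]
        congr 1
        push_cast; ring
      · simp [Finset.sum_range_succ]; ring
    · convert! hfs.hasSum using 1
      ext n
      simp only [f]
      congr 1
      push_cast; ring
  rw [jacobiTheta₂, hsum.tsum_eq]
  have e : 2 + ∑' n, f n + ∑' n, f n - 2 = 2 * ∑' n, f n := by ring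
  rw [e, norm_mul, Complex.norm_ofNat]
  have h2 : (1 - W)⁻¹ ≤ 3 / 2 := by
    rw [inv_le_comm₀ (by linarith) (by norm_num)]; linarith
  nlinarith

lemma norm_div_pi_cpow_half (z : ℂ) :
    ‖(z / Real.pi) ^ (1 / 2 : ℂ)‖ = Real.sqrt (‖z‖ / Real.pi) := by
  have : (1 / 2 : ℂ) = ((1 / 2 : ℝ) : ℂ) := by push_cast; rfl
  rw [this, Complex.norm_cpow_real, norm_div, Complex.norm_real, Real.norm_of_nonneg
    Real.pi_pos.le, Real.sqrt_eq_rpow]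

lemma norm_mainTerm (z : ℂ) : ‖mainTerm z‖ =
    1 / 2 * Real.sqrt (‖z‖ / Real.pi) * Real.exp (Real.pi ^ 2 / 4 * (1 / z).re) := by
  rw [mainTerm, norm_mul, norm_mul, norm_div_pi_cpow_half, Complex.norm_exp]
  have : (Real.pi : ℂ) ^ 2 / (4 * z) = ((Real.pi ^ 2 / 4 : ℝ) : ℂ) * (1 / z) := by
    push_cast; field_simp
  rw [this, Complex.re_ofReal_mul]
  norm_num

/-- The modular transformation of the theta function, applied to the generating function. -/
lemma overpartitionGF_eq {z : ℂ} (hz : 0 < z.re) :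
    overpartitionGF (Complex.exp (-z)) *
      jacobiTheta₂ (1 / 2 / (Complex.I * z / Real.pi)) (-1 / (Complex.I * z / Real.pi)) =
      2 * mainTerm z := by
  have h := overpartitionGF_mul_theta (norm_exp_neg_lt_one hz) (Complex.exp_ne_zero _)
  have hpi : (Real.pi : ℂ) ≠ 0 := by exact_mod_cast Real.pi_ne_zero
  have hz0 := ne_zero_of_re_pos hz
  have hI := Complex.I_ne_zero
  rw [tsum_eq_jacobiTheta₂, jacobiTheta₂_functional_equation] at h
  have e1 : -Complex.I * (Complex.I * z / Real.pi) = z / Real.pi := by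
    field_simp; linear_combination -Complex.I_sq
  have e2 : -Real.pi * Complex.I * (1 / 2) ^ 2 / (Complex.I * z / Real.pi) =
      -(Real.pi ^ 2 / (4 * z)) := by field_simp; norm_num
  rw [e1, e2] at h
  have h3 : (z / Real.pi) ^ (1 / 2 : ℂ) ≠ 0 := by
    rw [Ne, Complex.cpow_eq_zero_iff]; simp [hz0, hpi]
  have h4 : Complex.exp (-(Real.pi ^ 2 / (4 * z))) * Complex.exp (Real.pi ^ 2 / (4 * z)) = 1 := by
    rw [← Complex.exp_add, neg_add_cancel, Complex.exp_zero]
  rw [mainTerm]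
  set T := jacobiTheta₂ (1 / 2 / (Complex.I * z / Real.pi)) (-1 / (Complex.I * z / Real.pi))
  set G := overpartitionGF (Complex.exp (-z))
  set s := (z / Real.pi) ^ (1 / 2 : ℂ)
  have h5 : 1 / s * s = 1 := one_div_mul_cancel h3
  linear_combination s * Complex.exp (Real.pi ^ 2 / (4 * z)) * h - G * T * h4 * (1 / s * s) -
    G * T * h5

/-- On the region where `Re (1/z)` is not small, the generating function equals its main term up to
an error that is not exponentially large. -/
lemma norm_overpartitionGF_sub_mainTerm_le {z : ℂ} (hz : 0 < z.re)
    (hw : Real.exp (-2 * Real.pi ^ 2 * (1 / z).re) ≤ 1 / 3) :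
    ‖overpartitionGF (Complex.exp (-z)) - mainTerm z‖ ≤ 3 / 2 * Real.sqrt (‖z‖ / Real.pi) := by
  have h1 := overpartitionGF_eq hz
  have h2 := norm_jacobiTheta₂_sub_two_le hz hw
  set T := jacobiTheta₂ (1 / 2 / (Complex.I * z / Real.pi)) (-1 / (Complex.I * z / Real.pi))
  set W := Real.exp (-2 * Real.pi ^ 2 * (1 / z).re) with hW
  have hT : 1 ≤ ‖T‖ := by
    have h3 : ‖(2 : ℂ)‖ ≤ ‖T‖ + ‖T - 2‖ := by
      have := norm_sub_le T (T - 2)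
      simpa using this
    rw [Complex.norm_ofNat] at h3
    linarith
  have h4 : (overpartitionGF (Complex.exp (-z)) - mainTerm z) * T = -(mainTerm z * (T - 2)) := by
    linear_combination h1
  have h5 := congrArg norm h4
  rw [norm_mul, norm_neg, norm_mul, norm_mainTerm] at h5
  have h6 : Real.exp (Real.pi ^ 2 / 4 * (1 / z).re) * W ≤ 1 := by
    rw [hW, ← Real.exp_add, Real.exp_le_one_iff]
    have := re_inv_pos hz
    have : 0 ≤ Real.pi ^ 2 * (1 / z).re := by positivity
    linarith
  set s := Real.sqrt (‖z‖ / Real.pi)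
  have hs : 0 ≤ s := Real.sqrt_nonneg _
  set E := Real.exp (Real.pi ^ 2 / 4 * (1 / z).re)
  have hE : 0 < E := Real.exp_pos _
  calc ‖overpartitionGF (Complex.exp (-z)) - mainTerm z‖
      ≤ ‖overpartitionGF (Complex.exp (-z)) - mainTerm z‖ * ‖T‖ :=
        le_mul_of_one_le_right (norm_nonneg _) hT
    _ = 1 / 2 * s * E * ‖T - 2‖ := h5
    _ ≤ 1 / 2 * s * E * (3 * W) := by gcongr
    _ = 3 / 2 * s * (E * W) := by ring
    _ ≤ 3 / 2 * s * 1 := by gcongr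
    _ = _ := by ring

lemma exp_neg_le_third {x : ℝ} (hx : 2 ≤ x) : Real.exp (-x) ≤ 1 / 3 := by
  have h := Real.add_one_le_exp x
  rw [Real.exp_neg, one_div]
  exact inv_anti₀ (by norm_num) (by linarith)

lemma norm_overpartitionGF_real_le {y : ℝ} (hy : 0 < y) (hy1 : y ≤ 1) :
    ‖overpartitionGF (Real.exp (-y) : ℝ)‖ ≤
      Real.sqrt (y / Real.pi) * Real.exp (Real.pi ^ 2 / (4 * y)) := by
  have hp := Real.pi_gt_three
  have hre : (1 / (y : ℂ)).re = 1 / y := by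
    rw [← Complex.ofReal_one, ← Complex.ofReal_div, Complex.ofReal_re]
  have h1y : 1 ≤ 1 / y := by rw [le_div_iff₀ hy]; linarith
  have hpy : 9 ≤ Real.pi ^ 2 * (1 / y) := by nlinarith
  have h := norm_overpartitionGF_sub_mainTerm_le (z := y) (by simpa using hy) (by
    rw [hre, neg_mul, neg_mul]
    exact exp_neg_le_third (by nlinarith))
  have h2 := norm_mainTerm y
  rw [hre, show Real.pi ^ 2 / 4 * (1 / y) = Real.pi ^ 2 / (4 * y) by field_simp] at h2
  rw [Complex.norm_real, Real.norm_of_nonneg hy.le] at h h2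
  rw [← Complex.ofReal_neg, ← Complex.ofReal_exp] at h
  have h3 := norm_le_norm_add_norm_sub (mainTerm y) (overpartitionGF (Real.exp (-y) : ℝ))
  have h4 := Real.add_one_le_exp (Real.pi ^ 2 / (4 * y))
  have h5 : 9 / 4 ≤ Real.pi ^ 2 / (4 * y) := by
    rw [show Real.pi ^ 2 / (4 * y) = Real.pi ^ 2 * (1 / y) / 4 by field_simp]; linarith
  have hs := Real.sqrt_nonneg (y / Real.pi)
  rw [norm_sub_rev] at h3
  nlinarith

/-! ### The generating function away from `q = 1` -/

/-- All coefficients of `log ((1 + w) / (1 - w)) = 2 (w + w^3/3 + w^5/5 + ⋯)` are nonnegative, so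
each term has its largest real part at `‖w‖`; only the gain in the linear term is kept. -/
lemma norm_one_add_div_one_sub_le {w : ℂ} (hw : ‖w‖ < 1) :
    ‖(1 + w) / (1 - w)‖ ≤
      (1 + ‖w‖) / (1 - ‖w‖) * Real.exp (2 * (w.re - ‖w‖)) := by
  have key : ∀ v : ℂ, ‖v‖ < 1 → HasSum (fun n : ℕ => (v ^ n / n - (-v) ^ n / n).re)
      (Real.log (‖1 + v‖ / ‖1 - v‖)) := by
    intro v hv
    have h1 := Complex.hasSum_taylorSeries_neg_log hv
    have h2 := Complex.hasSum_taylorSeries_neg_log (z := -v) (by simpa using hv)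
    have h3 := Complex.hasSum_re (h1.sub h2)
    have n1 : ‖1 + v‖ ≠ 0 := by
      rw [norm_ne_zero_iff]; simpa using one_add_pow_ne_zero hv one_ne_zero
    have n2 : ‖1 - v‖ ≠ 0 := by
      rw [norm_ne_zero_iff]; simpa using one_sub_pow_ne_zero hv one_ne_zero
    convert! h3 using 1
    rw [Real.log_div n1 n2]
    simp [Complex.log_re]
    ring
  have hx0 := norm_nonneg w
  set x := ‖w‖ with hx
  have hxn : ‖(x : ℂ)‖ = x := by rw [Complex.norm_real, Real.norm_of_nonneg hx0]
  have h1 := key w hw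
  have h2 := key x (by rw [hxn]; exact hw)
  have hterm : ∀ n : ℕ, (w ^ n / n - (-w) ^ n / n).re ≤
      ((x : ℂ) ^ n / n - (-(x : ℂ)) ^ n / n).re := by
    intro n
    rcases n.even_or_odd with hn | hn
    · rw [hn.neg_pow, hn.neg_pow]; simp
    · rw [hn.neg_pow, hn.neg_pow]
      have e : ∀ v : ℂ, (v ^ n / n - -v ^ n / n).re = 2 / n * (v ^ n).re := fun v => by
        have : v ^ n / n - -v ^ n / n = ((2 / n : ℝ) : ℂ) * v ^ n := by push_cast; ring
        rw [this, Complex.re_ofReal_mul]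
      rw [e, e, ← Complex.ofReal_pow, Complex.ofReal_re]
      have : (w ^ n).re ≤ x ^ n := by
        rw [hx, ← norm_pow]; exact Complex.re_le_norm _
      gcongr
  have h3 := le_hasSum (h2.sub h1) 1 (fun n _ => sub_nonneg.2 (hterm n))
  have h4 : Real.log (‖1 + w‖ / ‖1 - w‖) ≤
      Real.log (‖1 + (x : ℂ)‖ / ‖1 - (x : ℂ)‖) + 2 * (w.re - x) := by
    simp at h3
    linarith
  have p1 : 0 < ‖1 + w‖ := norm_pos_iff.2 (by simpa using one_add_pow_ne_zero hw one_ne_zero)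
  have p2 : 0 < ‖1 - w‖ := norm_pos_iff.2 (by simpa using one_sub_pow_ne_zero hw one_ne_zero)
  have e1 : ‖1 + (x : ℂ)‖ = 1 + x := by
    rw [← Complex.ofReal_one, ← Complex.ofReal_add, Complex.norm_real, Real.norm_of_nonneg]
    positivity
  have e2 : ‖1 - (x : ℂ)‖ = 1 - x := by
    rw [← Complex.ofReal_one, ← Complex.ofReal_sub, Complex.norm_real, Real.norm_of_nonneg]
    linarith
  rw [e1, e2] at h4
  have p3 : 0 < (1 + x) / (1 - x) := div_pos (by linarith) (by linarith)
  rw [norm_div, ← Real.exp_log (div_pos p1 p2), ← Real.exp_log p3, ← Real.exp_add]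
  exact Real.exp_le_exp.2 h4

lemma norm_overpartitionProd_le {q : ℂ} (hq : ‖q‖ < 1) (N : ℕ) :
    ‖overpartitionProd N q‖ ≤ ‖overpartitionProd N (‖q‖ : ℂ)‖ *
      Real.exp (2 * ∑ i ∈ Finset.range N, ((q ^ i * q).re - ‖q‖ ^ i * ‖q‖)) := by
  induction N with
  | zero => simp [overpartitionProd]
  | succ N ih =>
    rw [overpartitionProd, overpartitionProd, Finset.prod_range_succ, Finset.prod_range_succ,
      ← overpartitionProd, ← overpartitionProd, Finset.sum_range_succ, mul_add, Real.exp_add,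
      norm_mul, norm_mul]
    have hq' : ‖q ^ (N + 1)‖ < 1 := by
      rw [norm_pow]; exact pow_lt_one₀ (norm_nonneg _) hq (by simp)
    have h := norm_one_add_div_one_sub_le hq'
    have h2 : ‖(1 + (‖q‖ : ℂ) ^ (N + 1)) / (1 - (‖q‖ : ℂ) ^ (N + 1))‖ =
        (1 + ‖q ^ (N + 1)‖) / (1 - ‖q ^ (N + 1)‖) := by
      rw [← Complex.ofReal_pow, ← norm_pow, ← Complex.ofReal_one, ← Complex.ofReal_add,
        ← Complex.ofReal_sub, ← Complex.ofReal_div, Complex.norm_real, Real.norm_of_nonneg]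
      exact div_nonneg (by positivity) (by linarith)
    rw [← h2, norm_pow, pow_succ q, pow_succ ‖q‖] at h
    rw [pow_succ q]
    calc _ ≤ _ := mul_le_mul ih h (norm_nonneg _) (by positivity)
      _ = _ := by ring

/-- The factor `exp (2 q / (1 - q))` of the generating function has its maximum on each circle at
the positive real point, and the logarithm of the cofactor has nonnegative coefficients. -/
lemma norm_overpartitionGF_le {q : ℂ} (hq : ‖q‖ < 1) :
    ‖overpartitionGF q‖ ≤ ‖overpartitionGF (‖q‖ : ℂ)‖ *
      Real.exp (2 * ((q / (1 - q)).re - ‖q‖ / (1 - ‖q‖))) := by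
  have hqr : ‖(‖q‖ : ℂ)‖ < 1 := by simpa using hq
  have h1 := (tendsto_overpartitionProd hq).norm
  have h2 := (tendsto_overpartitionProd hqr).norm
  have h3 : Tendsto (fun N => ∑ i ∈ Finset.range N, ((q ^ i * q).re - ‖q‖ ^ i * ‖q‖)) atTop
      (𝓝 ((q / (1 - q)).re - ‖q‖ / (1 - ‖q‖))) := by
    have a := Complex.hasSum_re ((hasSum_geometric_of_norm_lt_one hq).mul_right q)
    have b := (hasSum_geometric_of_lt_one (norm_nonneg q) hq).mul_right ‖q‖
    rw [inv_mul_eq_div] at a b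
    exact (a.sub b).tendsto_sum_nat
  exact le_of_tendsto_of_tendsto' h1 (h2.mul ((Real.continuous_exp.tendsto _).comp
    (h3.const_mul 2))) fun N => norm_overpartitionProd_le hq N

/-- With `q = exp (-z)`, `z = y + θ i` and `r = |q|`, one has `|1 - q|² ≥ (1 - r)² (1 + 4 r)` on the
arc `π y ≤ |θ|`, so `Re (q / (1 - q))` falls short of `r / (1 - r) ≈ 1 / y` by a fixed fraction. -/
lemma two_mul_re_div_one_sub_sub_le {y θ : ℝ} (hy : 0 < y) (hy1 : y ≤ 7 / 100)
    (h1 : Real.pi * y ≤ |θ|) (h2 : |θ| ≤ Real.pi) :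
    2 * ((Complex.exp (-(y + θ * Complex.I)) / (1 - Complex.exp (-(y + θ * Complex.I)))).re -
      Real.exp (-y) / (1 - Real.exp (-y))) ≤ -(3 / 2) / y := by
  set r := Real.exp (-y) with hr
  have hr1 : 1 - y ≤ r := by have := Real.add_one_le_exp (-y); linarith
  have hr2 : r < 1 := by rw [hr, Real.exp_lt_one_iff]; linarith
  have hq : Complex.exp (-(y + θ * Complex.I)) = (r * Real.cos θ : ℝ) + (-(r * Real.sin θ) : ℝ) *
      Complex.I := by
    rw [neg_add, Complex.exp_add, ← Complex.ofReal_neg, ← Complex.ofReal_exp, ← neg_mul,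
      ← Complex.ofReal_neg θ, Complex.exp_mul_I, ← Complex.ofReal_cos, ← Complex.ofReal_sin,
      Real.cos_neg, Real.sin_neg, ← hr]
    push_cast
    ring
  set c := Real.cos θ with hc
  have hcs : c ^ 2 + Real.sin θ ^ 2 = 1 := Real.cos_sq_add_sin_sq θ
  -- Jordan's inequality for `sin (θ / 2)`
  have hcos : 1 - c ≥ 2 * y ^ 2 := by
    have e : 1 - c = 2 * Real.sin (|θ| / 2) ^ 2 := by
      have := Real.cos_sq (|θ| / 2)
      have h3 := Real.sin_sq_add_cos_sq (|θ| / 2)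
      rw [mul_div_cancel₀ _ (two_ne_zero), Real.cos_abs] at this
      rw [hc]; linarith
    have hj := Real.mul_le_sin (x := |θ| / 2) (by positivity) (by linarith)
    have hyl : y ≤ 2 / Real.pi * (|θ| / 2) := by
      rw [show 2 / Real.pi * (|θ| / 2) = |θ| / Real.pi by field_simp, le_div_iff₀ Real.pi_pos]
      linarith
    have : y ≤ Real.sin (|θ| / 2) := hyl.trans hj
    rw [e]
    nlinarith
  -- `D = |1 - q|²`
  set D := 1 - 2 * r * c + r ^ 2 with hD
  have hDlow : (1 - r) ^ 2 * (1 + 4 * r) ≤ D := by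
    have : D = (1 - r) ^ 2 + 2 * r * (1 - c) := by rw [hD]; ring
    have h3 : (1 - r) ^ 2 ≤ y ^ 2 := by nlinarith
    have h4 : 2 * r * (2 * y ^ 2) ≤ 2 * r * (1 - c) := by
      have : 0 < r := Real.exp_pos _
      gcongr
    have h5 : 4 * r * (1 - r) ^ 2 ≤ 4 * r * y ^ 2 := by
      have : 0 < r := Real.exp_pos _
      gcongr
    nlinarith
  have hr0 : 0 < r := Real.exp_pos _
  have hd0 : 0 < 1 - r := by linarith
  have hD0 : 0 < D := lt_of_lt_of_le (by positivity) hDlow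
  have hre : (Complex.exp (-(y + θ * Complex.I)) / (1 - Complex.exp (-(y + θ * Complex.I)))).re =
      (r * c - r ^ 2) / D := by
    rw [hq]
    have hn : Complex.normSq (1 - ((r * c : ℝ) + (-(r * Real.sin θ) : ℝ) * Complex.I)) = D := by
      rw [Complex.normSq_apply]
      simp only [Complex.sub_re, Complex.add_re, Complex.mul_re, Complex.ofReal_re, Complex.I_re,
        Complex.ofReal_im, Complex.I_im, Complex.one_re, Complex.one_im, Complex.sub_im,
        Complex.add_im, Complex.mul_im]
      rw [hD]
      linear_combination r ^ 2 * hcs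
    rw [Complex.div_re, hn]
    simp only [Complex.sub_re, Complex.add_re, Complex.mul_re, Complex.ofReal_re, Complex.I_re,
      Complex.ofReal_im, Complex.I_im, Complex.one_re, Complex.one_im, Complex.sub_im,
      Complex.add_im, Complex.mul_im]
    rw [← add_div]
    congr 1
    linear_combination -r ^ 2 * hcs
  rw [hre]
  have h6 : 2 * ((r * c - r ^ 2) / D - r / (1 - r)) =
      -((1 + r) / (1 - r)) + (1 + r) / (1 - r) * ((1 - r) ^ 2 / D) := by
    have : D ≠ 0 := hD0.ne'
    have : 1 - r ≠ 0 := hd0.ne'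
    field_simp
    rw [hD]
    ring
  have h7 : (1 - r) ^ 2 / D ≤ 1 / 4.72 := by
    rw [div_le_div_iff₀ hD0 (by norm_num)]
    have : (1 - r) ^ 2 * 4.72 ≤ (1 - r) ^ 2 * (1 + 4 * r) := by
      gcongr
      linarith
    linarith
  have h8 : 2 / y - 1 ≤ (1 + r) / (1 - r) := by
    rw [le_div_iff₀ hd0, sub_mul, sub_le_iff_le_add, div_mul_eq_mul_div, div_le_iff₀ hy]
    nlinarith
  have h9 : 0 < (1 + r) / (1 - r) := by positivity
  rw [h6]
  have h10 : -((1 + r) / (1 - r)) + (1 + r) / (1 - r) * ((1 - r) ^ 2 / D) ≤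
      -((1 + r) / (1 - r)) + (1 + r) / (1 - r) * (1 / 4.72) := by gcongr
  refine h10.trans ?_
  have h11 : 1 ≤ 7 / 100 * (1 / y) := by
    rw [mul_one_div, le_div_iff₀ hy]; linarith
  have h12 : 2 / y = 2 * (1 / y) := by ring
  have h13 : -(3 / 2) / y = -(3 / 2) * (1 / y) := by ring
  rw [h13]
  rw [h12] at h8
  linarith

lemma norm_overpartitionGF_minor_le {y θ : ℝ} (hy : 0 < y) (hy1 : y ≤ 7 / 100)
    (h1 : Real.pi * y ≤ |θ|) (h2 : |θ| ≤ Real.pi) :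
    ‖overpartitionGF (Complex.exp (-(y + θ * Complex.I)))‖ ≤
      Real.sqrt (y / Real.pi) * Real.exp (Real.pi ^ 2 / (4 * y)) * Real.exp (-(3 / 2) / y) := by
  have hn : ‖Complex.exp (-(y + θ * Complex.I))‖ = Real.exp (-y) := by
    rw [Complex.norm_exp]; simp
  have h := norm_overpartitionGF_le (q := Complex.exp (-(y + θ * Complex.I))) (by rw [hn]; simpa)
  rw [hn] at h
  exact h.trans (mul_le_mul (norm_overpartitionGF_real_le hy (by linarith))
    (Real.exp_le_exp.2 (two_mul_re_div_one_sub_sub_le hy hy1 h1 h2)) (Real.exp_pos _).le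
    (by positivity))

end

section

open Filter Topology MeasureTheory Set
open scoped FourierTransform

/-! ### The inverse Laplace transform of the main term -/

/-- The second derivative of `mainTerm`. -/
noncomputable def mainTermDerivTwo (z : ℂ) : ℂ :=
  mainTerm z * (-1 / (4 * z ^ 2) + Real.pi ^ 2 / (4 * z ^ 3) + Real.pi ^ 4 / (16 * z ^ 4))

/-- The function `t² M(t)`, where `M(t) = sinh(π√t)/(4t) - cosh(π√t)/(4π t^(3/2))` approximates
`p̄(t)`. As `Real.sqrt` vanishes on the negative axis, so does this function, and it is
continuous. -/
noncomputable def laplaceKernel (t : ℝ) : ℝ :=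
  (t * Real.sinh (Real.pi * √t) - √t * Real.cosh (Real.pi * √t) / Real.pi) / 4

lemma laplaceKernel_of_nonpos {t : ℝ} (ht : t ≤ 0) : laplaceKernel t = 0 := by
  simp [laplaceKernel, Real.sqrt_eq_zero_of_nonpos ht]

lemma continuous_laplaceKernel : Continuous laplaceKernel := by
  unfold laplaceKernel
  fun_prop

/-- The integrand of the Gaussian moment of order `k`. -/
noncomputable def gaussMoment (z : ℂ) (k : ℕ) (u : ℝ) : ℂ :=
  (u : ℂ) ^ k * Complex.exp (-z * u ^ 2 + Real.pi * u)

lemma continuous_gaussMoment (z : ℂ) (k : ℕ) : Continuous (gaussMoment z k) := by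
  unfold gaussMoment
  fun_prop

lemma integrable_gaussMoment {z : ℂ} (hz : 0 < z.re) (k : ℕ) : Integrable (gaussMoment z k) := by
  have h : ∀ c : ℂ, Integrable fun u : ℝ => ‖Complex.exp (-z * u ^ 2 + c * u)‖ := fun c => by
    simpa using (integrable_cexp_quadratic hz c 0).norm
  refine Integrable.mono' (((h (Real.pi + 1)).add (h (Real.pi - 1))).const_mul (k.factorial : ℝ))
    (continuous_gaussMoment z k).aestronglyMeasurable (Eventually.of_forall fun u => ?_)
  have e : ∀ s : ℝ, ‖Complex.exp (-z * u ^ 2 + (Real.pi + s) * u)‖ =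
      ‖Complex.exp (-z * u ^ 2 + Real.pi * u)‖ * Real.exp (s * u) := fun s => by
    rw [add_mul, ← add_assoc, Complex.exp_add, norm_mul]
    congr 1
    rw [← Complex.ofReal_mul, ← Complex.ofReal_exp, Complex.norm_real,
      Real.norm_of_nonneg (Real.exp_pos _).le]
  have e1 := e 1
  have e2 := e (-1)
  push_cast at e1 e2
  rw [← sub_eq_add_neg] at e2
  simp only [Pi.add_apply]
  rw [e1, e2, gaussMoment, norm_mul, norm_pow, Complex.norm_real, Real.norm_eq_abs]
  have h1 : |u| ^ k ≤ k.factorial * (Real.exp (1 * u) + Real.exp (-1 * u)) := by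
    have h2 := Real.pow_div_factorial_le_exp |u| (abs_nonneg u) k
    rw [div_le_iff₀ (by positivity), mul_comm] at h2
    refine h2.trans ?_
    gcongr
    rcases abs_cases u with ⟨h, _⟩ | ⟨h, _⟩
    · rw [h, one_mul]; linarith [Real.exp_pos (-1 * u)]
    · rw [h, neg_one_mul]; linarith [Real.exp_pos (1 * u)]
  calc _ ≤ k.factorial * (Real.exp (1 * u) + Real.exp (-1 * u)) *
        ‖Complex.exp (-z * u ^ 2 + Real.pi * u)‖ := by gcongr
    _ = _ := by ring

lemma integral_gaussMoment_zero {z : ℂ} (hz : 0 < z.re) :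
    ∫ u, gaussMoment z 0 u = 2 * Real.pi / z * mainTerm z := by
  have hz0 := ne_zero_of_re_pos hz
  have hpi : (Real.pi : ℂ) ≠ 0 := by exact_mod_cast Real.pi_ne_zero
  have h := integral_cexp_quadratic (b := -z) (by simpa using hz) Real.pi 0
  have e : ∀ u : ℝ, gaussMoment z 0 u = Complex.exp (-z * u ^ 2 + Real.pi * u + 0) := fun u => by
    simp [gaussMoment]
  simp only [e]
  have e2 : (0 - (Real.pi : ℂ) ^ 2 / (4 * -z)) = Real.pi ^ 2 / (4 * z) := by field_simp; ring
  rw [h, neg_neg, mainTerm, e2]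
  have h1 : (Real.pi / z : ℂ) ^ (1 / 2 : ℂ) = Real.pi / z * (z / Real.pi) ^ (1 / 2 : ℂ) := by
    have harg : (z / Real.pi).arg ≠ Real.pi := by
      have : 0 < (z / Real.pi).re := by
        rw [Complex.div_ofReal_re]; exact div_pos hz Real.pi_pos
      have h1 := Complex.abs_arg_lt_pi_div_two_iff.2 (Or.inl this)
      have h2 := Real.pi_pos
      intro h3
      rw [h3, abs_of_pos h2] at h1
      linarith
    have h3 : (z / Real.pi) ≠ 0 := div_ne_zero hz0 hpi
    rw [← inv_div, Complex.inv_cpow _ _ harg]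
    have h4 : (z / Real.pi) ^ (1 / 2 : ℂ) * (z / Real.pi) ^ (1 / 2 : ℂ) = z / Real.pi := by
      rw [← Complex.cpow_add _ _ h3]; norm_num
    obtain ⟨s, hs⟩ : ∃ s, s = (z / Real.pi) ^ (1 / 2 : ℂ) := ⟨_, rfl⟩
    rw [← hs] at h4 ⊢
    have h5 : s ≠ 0 := by
      rintro rfl; rw [zero_mul] at h4; exact h3 h4.symm
    rw [← h4]
    field_simp
  rw [h1]
  ring

/-- Integration by parts for Gaussian moments. The truncated `k - 1` is harmless at `k = 0`, where
its coefficient vanishes. -/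
lemma integral_gaussMoment_succ {z : ℂ} (hz : 0 < z.re) (k : ℕ) :
    2 * z * ∫ u, gaussMoment z (k + 1) u =
      Real.pi * (∫ u, gaussMoment z k u) + k * ∫ u, gaussMoment z (k - 1) u := by
  have hd : ∀ u : ℝ, HasDerivAt (gaussMoment z k)
      (k * gaussMoment z (k - 1) u + Real.pi * gaussMoment z k u -
        2 * z * gaussMoment z (k + 1) u) u := by
    intro u
    have h1 : HasDerivAt (fun u : ℝ => (u : ℂ)) 1 u := Complex.ofRealCLM.hasDerivAt
    have h2 := ((h1.pow 2).const_mul (-z)).add (h1.const_mul (Real.pi : ℂ))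
    have h3 := (h1.pow k).mul h2.cexp
    convert! h3 using 1
    simp only [gaussMoment, Pi.add_apply, Pi.pow_apply]
    push_cast
    ring
  have i0 := (integrable_gaussMoment hz (k - 1)).const_mul (k : ℂ)
  have i1 := (integrable_gaussMoment hz k).const_mul (Real.pi : ℂ)
  have i2 := (integrable_gaussMoment hz (k + 1)).const_mul (2 * z)
  have h := integral_eq_zero_of_hasDerivAt_of_integrable hd ((i0.add i1).sub i2)
    (integrable_gaussMoment hz k)
  have e : ∫ u, (k * gaussMoment z (k - 1) u + Real.pi * gaussMoment z k u -
      2 * z * gaussMoment z (k + 1) u) = k * (∫ u, gaussMoment z (k - 1) u) +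
      Real.pi * (∫ u, gaussMoment z k u) - 2 * z * ∫ u, gaussMoment z (k + 1) u := by
    have j1 := integral_sub (i0.add i1) i2
    have j2 := integral_add i0 i1
    simp only [Pi.add_apply] at j1
    rw [j1, j2, integral_const_mul, integral_const_mul, integral_const_mul]
  rw [e] at h
  linear_combination -h

lemma integral_gaussMoment_combination {z : ℂ} (hz : 0 < z.re) :
    ∫ u, (gaussMoment z 3 u - gaussMoment z 2 u / Real.pi) = 4 * mainTermDerivTwo z := by
  have hz0 := ne_zero_of_re_pos hz
  have hpi : (Real.pi : ℂ) ≠ 0 := by exact_mod_cast Real.pi_ne_zero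
  rw [integral_sub (integrable_gaussMoment hz 3) ((integrable_gaussMoment hz 2).div_const _),
    integral_div]
  have h0 := integral_gaussMoment_zero hz
  have h1 := integral_gaussMoment_succ hz 0
  have h2 := integral_gaussMoment_succ hz 1
  have h3 := integral_gaussMoment_succ hz 2
  simp only [zero_add, Nat.cast_zero, zero_mul, add_zero, Nat.reduceAdd, Nat.cast_one,
    Nat.sub_self, Nat.cast_ofNat, Nat.add_one_sub_one] at h1 h2 h3
  rw [h0] at h1 h2
  set I1 := ∫ u, gaussMoment z 1 u
  set I2 := ∫ u, gaussMoment z 2 u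
  set I3 := ∫ u, gaussMoment z 3 u
  have h2z : 2 * z ≠ 0 := mul_ne_zero two_ne_zero hz0
  have e1 : I1 = (Real.pi * (2 * Real.pi / z * mainTerm z)) / (2 * z) := by
    rw [eq_div_iff h2z]; linear_combination h1
  have e2 : I2 = (Real.pi * I1 + 1 * (2 * Real.pi / z * mainTerm z)) / (2 * z) := by
    rw [eq_div_iff h2z]; linear_combination h2
  have e3 : I3 = (Real.pi * I2 + 2 * I1) / (2 * z) := by
    rw [eq_div_iff h2z]; linear_combination h3
  rw [mainTermDerivTwo, e3, e2, e1]
  field_simp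
  ring

lemma laplaceKernel_sq (z : ℂ) {u : ℝ} (hu : 0 < u) :
    (2 * u : ℝ) • ((laplaceKernel (u ^ 2) : ℂ) * Complex.exp (-z * (u ^ 2 : ℝ))) =
      ((gaussMoment z 3 u - gaussMoment z 2 u / Real.pi) +
        (gaussMoment z 3 (-u) - gaussMoment z 2 (-u) / Real.pi)) / 4 := by
  rw [laplaceKernel, Real.sqrt_sq hu.le, Complex.real_smul]
  simp only [gaussMoment]
  have e1 : Complex.exp (-z * (u : ℂ) ^ 2 + Real.pi * u) =
      Complex.exp (-z * u ^ 2) * Complex.exp (Real.pi * u) := Complex.exp_add _ _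
  have e2 : Complex.exp (-z * ((-u : ℝ) : ℂ) ^ 2 + Real.pi * ((-u : ℝ) : ℂ)) =
      Complex.exp (-z * u ^ 2) * Complex.exp (-(Real.pi * u)) := by
    rw [← Complex.exp_add]; push_cast; ring_nf
  rw [e1, e2]
  push_cast
  rw [Complex.sinh, Complex.cosh]
  ring

lemma integrable_laplaceKernel {z : ℂ} (hz : 0 < z.re) :
    IntegrableOn (fun t : ℝ => (laplaceKernel t : ℂ) * Complex.exp (-z * t)) (Ioi 0) := by
  rw [← integrableOn_Ioi_comp_rpow_iff _ (two_ne_zero' ℝ)]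
  have i1 := (integrable_gaussMoment hz 3).sub ((integrable_gaussMoment hz 2).div_const
    (Real.pi : ℂ))
  refine (((i1.add i1.comp_neg).div_const 4).integrableOn (s := Ioi 0)).congr_fun
    (fun u hu => ?_) measurableSet_Ioi
  have := laplaceKernel_sq z hu
  simp only [Pi.add_apply, Pi.sub_apply]
  rw [← this]
  norm_num

/-- The Laplace transform of `laplaceKernel`, computed by the substitution `t = u²`. -/
lemma integral_laplaceKernel {z : ℂ} (hz : 0 < z.re) :
    ∫ t : ℝ in Ioi 0, (laplaceKernel t : ℂ) * Complex.exp (-z * t) = mainTermDerivTwo z := by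
  rw [← integral_comp_rpow_Ioi_of_pos zero_lt_two]
  have i1 := (integrable_gaussMoment hz 3).sub ((integrable_gaussMoment hz 2).div_const
    (Real.pi : ℂ))
  set φ : ℝ → ℂ := fun u => gaussMoment z 3 u - gaussMoment z 2 u / Real.pi with hφ
  have i2 : Integrable φ := i1
  have h1 : ∫ u : ℝ in Ioi 0, (2 * u ^ ((2 : ℝ) - 1)) • ((laplaceKernel (u ^ (2 : ℝ)) : ℂ) *
      Complex.exp (-z * (u ^ (2 : ℝ) : ℝ))) = ∫ u : ℝ in Ioi 0, (φ u + φ (-u)) / 4 := by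
    refine setIntegral_congr_fun measurableSet_Ioi fun u hu => ?_
    have := laplaceKernel_sq z hu
    simp only [hφ]
    rw [← this]
    norm_num
  rw [h1, integral_div, integral_add i2.integrableOn i2.comp_neg.integrableOn,
    integral_comp_neg_Ioi, neg_zero, ← compl_Ioi, integral_add_compl measurableSet_Ioi i2,
    integral_gaussMoment_combination hz]
  ring

/-- The vertical line through `y`. -/
noncomputable def lineAt (y θ : ℝ) : ℂ := y + θ * Complex.I

lemma lineAt_re (y θ : ℝ) : (lineAt y θ).re = y := by simp [lineAt]

lemma lineAt_im (y θ : ℝ) : (lineAt y θ).im = θ := by simp [lineAt]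

lemma abs_le_norm_lineAt (y θ : ℝ) : |θ| ≤ ‖lineAt y θ‖ := by
  simpa [lineAt_im] using Complex.abs_im_le_norm (lineAt y θ)

lemma le_norm_lineAt (y θ : ℝ) : y ≤ ‖lineAt y θ‖ := by
  simpa [lineAt_re] using Complex.re_le_norm (lineAt y θ)

lemma norm_mainTermDerivTwo_le (z : ℂ) {R e : ℝ} (hR : 0 < R) (hzR : R ≤ ‖z‖)
    (he : Real.pi ^ 2 / 4 * (1 / z).re ≤ e) :
    ‖mainTermDerivTwo z‖ ≤ 1 / 2 * Real.exp e * (1 / 4 + 3 / R + 7 / R ^ 2) *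
      ‖z‖ ^ (-(3 / 2) : ℝ) := by
  have hz : 0 < ‖z‖ := hR.trans_le hzR
  have hp := Real.pi_lt_d2
  have hp0 := Real.pi_gt_three
  rw [mainTermDerivTwo, norm_mul, norm_mainTerm]
  have h1 : ‖-1 / (4 * z ^ 2) + Real.pi ^ 2 / (4 * z ^ 3) + Real.pi ^ 4 / (16 * z ^ 4)‖ ≤
      (1 / 4 + 3 / R + 7 / R ^ 2) * ‖z‖ ^ (-2 : ℝ) := by
    have a1 : ‖-1 / (4 * z ^ 2)‖ = 1 / 4 * (1 / ‖z‖ ^ 2) := by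
      rw [norm_div, norm_mul, norm_pow]; norm_num; ring
    have a2 : ‖(Real.pi : ℂ) ^ 2 / (4 * z ^ 3)‖ = Real.pi ^ 2 / 4 / ‖z‖ * (1 / ‖z‖ ^ 2) := by
      rw [norm_div, norm_mul, norm_pow, norm_pow, Complex.norm_real,
        Real.norm_of_nonneg Real.pi_pos.le]; norm_num; field_simp
    have a3 : ‖(Real.pi : ℂ) ^ 4 / (16 * z ^ 4)‖ = Real.pi ^ 4 / 16 / ‖z‖ ^ 2 * (1 / ‖z‖ ^ 2) := by
      rw [norm_div, norm_mul, norm_pow, norm_pow, Complex.norm_real,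
        Real.norm_of_nonneg Real.pi_pos.le]; norm_num; field_simp
    have b2 : Real.pi ^ 2 / 4 / ‖z‖ ≤ 3 / R := by
      have : Real.pi ^ 2 / 4 ≤ 3 := by nlinarith
      gcongr
    have b3 : Real.pi ^ 4 / 16 / ‖z‖ ^ 2 ≤ 7 / R ^ 2 := by
      have h2 : Real.pi ^ 2 ≤ 10 := by nlinarith
      have : Real.pi ^ 4 / 16 ≤ 7 := by nlinarith [sq_nonneg (Real.pi ^ 2)]
      gcongr
    refine (norm_add₃_le).trans ?_
    rw [a1, a2, a3, Real.rpow_neg hz.le, ← one_div,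
      show ‖z‖ ^ (2 : ℝ) = ‖z‖ ^ 2 by exact_mod_cast Real.rpow_natCast ‖z‖ 2, ← add_mul, ← add_mul]
    gcongr
  have h2 : √(‖z‖ / Real.pi) ≤ ‖z‖ ^ (1 / 2 : ℝ) := by
    rw [← Real.sqrt_eq_rpow]
    refine Real.sqrt_le_sqrt (div_le_self hz.le (by linarith))
  calc _ ≤ 1 / 2 * ‖z‖ ^ (1 / 2 : ℝ) * Real.exp e *
        ((1 / 4 + 3 / R + 7 / R ^ 2) * ‖z‖ ^ (-2 : ℝ)) := by gcongr
    _ = 1 / 2 * Real.exp e * (1 / 4 + 3 / R + 7 / R ^ 2) *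
        (‖z‖ ^ (1 / 2 : ℝ) * ‖z‖ ^ (-2 : ℝ)) := by ring
    _ = _ := by rw [← Real.rpow_add hz]; norm_num

lemma one_div_lineAt_re (y θ : ℝ) : (1 / lineAt y θ).re = y / (y ^ 2 + θ ^ 2) := by
  rw [one_div, Complex.inv_re, Complex.normSq_apply, lineAt_re, lineAt_im]
  ring_nf

lemma continuous_mainTerm_lineAt {y : ℝ} (hy : 0 < y) :
    Continuous fun θ : ℝ => mainTerm (lineAt y θ) := by
  have h0 : ∀ θ, lineAt y θ ≠ 0 := fun θ => ne_zero_of_re_pos (by rwa [lineAt_re])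
  have hc : Continuous fun θ : ℝ => lineAt y θ := by unfold lineAt; fun_prop
  unfold mainTerm
  refine (continuous_const.mul ?_).mul (Complex.continuous_exp.comp
    (continuous_const.div (continuous_const.mul hc) fun θ => by simp [h0 θ]))
  refine (hc.div_const _).cpow continuous_const fun θ => ?_
  left
  rw [Complex.div_ofReal_re, lineAt_re]
  exact div_pos hy Real.pi_pos

lemma continuous_mainTermDerivTwo_lineAt {y : ℝ} (hy : 0 < y) :
    Continuous fun θ : ℝ => mainTermDerivTwo (lineAt y θ) := by
  have h0 : ∀ θ, lineAt y θ ≠ 0 := fun θ => ne_zero_of_re_pos (by rwa [lineAt_re])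
  have hc : Continuous fun θ : ℝ => lineAt y θ := by unfold lineAt; fun_prop
  unfold mainTermDerivTwo
  refine (continuous_mainTerm_lineAt hy).mul ?_
  refine ((continuous_const.div (by fun_prop) fun θ => ?_).add
    (continuous_const.div (by fun_prop) fun θ => ?_)).add
    (continuous_const.div (by fun_prop) fun θ => ?_) <;> simp [h0 θ]

lemma integrable_mainTermDerivTwo_lineAt {y : ℝ} (hy : 0 < y) :
    Integrable fun θ : ℝ => mainTermDerivTwo (lineAt y θ) := by
  have hb := integrable_one_add_norm (E := ℝ) (μ := volume) (r := 3 / 2)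
    (by rw [Module.finrank_self]; norm_num)
  refine Integrable.mono' (hb.const_mul (1 / 2 * Real.exp (Real.pi ^ 2 / 4 * (1 / y)) *
    (1 / 4 + 3 / y + 7 / y ^ 2) * (1 + 1 / y) ^ (3 / 2 : ℝ)))
    (continuous_mainTermDerivTwo_lineAt hy).aestronglyMeasurable (Eventually.of_forall fun θ => ?_)
  have h1 := le_norm_lineAt y θ
  have h2 := abs_le_norm_lineAt y θ
  have h3 : 0 < ‖lineAt y θ‖ := hy.trans_le h1
  refine (norm_mainTermDerivTwo_le _ hy h1 (e := Real.pi ^ 2 / 4 * (1 / y)) ?_).trans ?_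
  · rw [one_div_lineAt_re]
    refine mul_le_mul_of_nonneg_left ?_ (by positivity)
    rw [div_le_div_iff₀ (by positivity) hy]
    nlinarith [sq_nonneg θ]
  · have h4 : 1 + |θ| ≤ (1 + 1 / y) * ‖lineAt y θ‖ := by
      have : 1 ≤ 1 / y * ‖lineAt y θ‖ := by
        rw [one_div_mul_eq_div, le_div_iff₀ hy]; linarith
      linarith
    have h5 : ‖lineAt y θ‖ ^ (-(3 / 2) : ℝ) ≤
        (1 + 1 / y) ^ (3 / 2 : ℝ) * (1 + ‖θ‖) ^ (-(3 / 2) : ℝ) := by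
      rw [Real.rpow_neg h3.le, Real.rpow_neg (by positivity), Real.norm_eq_abs, ← div_eq_mul_inv,
        le_div_iff₀ (by positivity), inv_mul_le_iff₀ (by positivity), mul_comm,
        ← Real.mul_rpow (by positivity) h3.le]
      exact Real.rpow_le_rpow (by positivity) h4 (by norm_num)
    calc _ ≤ 1 / 2 * Real.exp (Real.pi ^ 2 / 4 * (1 / y)) *
        (1 / 4 + 3 / y + 7 / y ^ 2) * ((1 + 1 / y) ^ (3 / 2 : ℝ) * (1 + ‖θ‖) ^ (-(3 / 2) : ℝ)) := by
          gcongr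
      _ = _ := by ring

/-- Fourier inversion on the line `Re z = y`. -/
lemma integral_mainTermDerivTwo_lineAt {y : ℝ} (hy : 0 < y) (t : ℝ) :
    ∫ θ : ℝ, mainTermDerivTwo (lineAt y θ) * Complex.exp (t * lineAt y θ) =
      2 * Real.pi * laplaceKernel t := by
  let f : ℝ → ℂ := fun t => (laplaceKernel t : ℂ) * Complex.exp (-y * t)
  have hfc : Continuous f := by
    have := continuous_laplaceKernel
    fun_prop
  have hsupp : ∀ (g : ℝ → ℂ), (fun t => g t * f t) = indicator (Ioi 0) fun t => g t * f t := by
    intro g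
    ext t
    by_cases h : t ∈ Ioi (0 : ℝ)
    · rw [indicator_of_mem h]
    · rw [indicator_of_notMem h]
      simp [f, laplaceKernel_of_nonpos (not_lt.1 h)]
  have hf : Integrable f := by
    have h1 : f = indicator (Ioi 0) f := by simpa using hsupp 1
    rw [h1, integrable_indicator_iff measurableSet_Ioi]
    exact integrable_laplaceKernel (z := y) (by simpa using hy)
  have hF : ∀ ξ : ℝ, 𝓕 f ξ = mainTermDerivTwo (lineAt y (2 * Real.pi * ξ)) := by
    intro ξ
    rw [Real.fourier_real_eq_integral_exp_smul]
    simp only [smul_eq_mul]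
    rw [hsupp, integral_indicator measurableSet_Ioi,
      ← integral_laplaceKernel (z := lineAt y (2 * Real.pi * ξ)) (by rwa [lineAt_re])]
    congr 1
    ext t
    simp only [f, lineAt]
    rw [mul_left_comm, ← Complex.exp_add]
    congr 2
    push_cast
    ring
  have hFi : Integrable (𝓕 f) := by
    have := (integrable_mainTermDerivTwo_lineAt hy).comp_mul_left' (R := 2 * Real.pi)
      (by positivity)
    refine this.congr (Eventually.of_forall fun ξ => (hF ξ).symm)
  have hinv := congrFun (hfc.fourierInv_fourier_eq hf hFi) t
  rw [Real.fourierInv_eq'] at hinv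
  simp only [hF] at hinv
  have hsub := Measure.integral_comp_mul_left (fun θ : ℝ => Complex.exp ((t * θ : ℝ) * Complex.I) •
    mainTermDerivTwo (lineAt y θ)) (2 * Real.pi)
  have e1 : ∀ ξ : ℝ, (2 * Real.pi * inner ℝ ξ t : ℝ) = t * (2 * Real.pi * ξ) := fun ξ => by
    simp; ring
  simp only [e1] at hinv
  rw [hsub] at hinv
  have e2 : ∀ θ : ℝ, mainTermDerivTwo (lineAt y θ) * Complex.exp (t * lineAt y θ) =
      Complex.exp (y * t) * (Complex.exp ((t * θ : ℝ) * Complex.I) •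
        mainTermDerivTwo (lineAt y θ)) := by
    intro θ
    rw [lineAt, mul_add, Complex.exp_add, smul_eq_mul]
    push_cast
    ring_nf
  simp only [e2]
  rw [integral_const_mul]
  have hp := Real.pi_pos
  rw [abs_of_pos (by positivity), Complex.real_smul] at hinv
  obtain ⟨J, hJ⟩ : ∃ J, J = ∫ θ : ℝ, Complex.exp ((t * θ : ℝ) * Complex.I) •
    mainTermDerivTwo (lineAt y θ) := ⟨_, rfl⟩
  rw [← hJ] at hinv ⊢
  have hpi : (Real.pi : ℂ) ≠ 0 := by exact_mod_cast Real.pi_ne_zero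
  have e3 : J = 2 * Real.pi * f t := by
    rw [← hinv]
    push_cast
    field_simp
  rw [e3]
  simp only [f]
  have e4 : Complex.exp (y * t) * Complex.exp (-y * t) = 1 := by
    rw [← Complex.exp_add]; simp
  linear_combination 2 * Real.pi * (laplaceKernel t : ℂ) * e4

end

section

open Filter Topology MeasureTheory Set

/-! ### The circle method -/

lemma hasDerivAt_mainTerm {z : ℂ} (hz : 0 < z.re) :
    HasDerivAt mainTerm (mainTerm z * (1 / (2 * z) - Real.pi ^ 2 / (4 * z ^ 2))) z := by
  have hz0 := ne_zero_of_re_pos hz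
  have hpi : (Real.pi : ℂ) ≠ 0 := by exact_mod_cast Real.pi_ne_zero
  have h1 : HasDerivAt (fun z : ℂ => (z / Real.pi) ^ (1 / 2 : ℂ))
      ((1 / 2 : ℂ) * (z / Real.pi) ^ ((1 / 2 : ℂ) - 1) * (1 / Real.pi)) z := by
    refine ((hasDerivAt_id z).div_const (Real.pi : ℂ)).cpow_const ?_
    left
    simp only [id]
    rw [Complex.div_ofReal_re]
    exact div_pos hz Real.pi_pos
  have h2 : HasDerivAt (fun z : ℂ => (Real.pi : ℂ) ^ 2 / (4 * z))
      (-(Real.pi ^ 2 / (4 * z ^ 2))) z := by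
    have := ((hasDerivAt_inv hz0).const_mul ((Real.pi : ℂ) ^ 2 / 4))
    convert! this using 1
    · ext w; field_simp
    · field_simp
  have h3 := (h1.const_mul (1 / 2 : ℂ)).mul h2.cexp
  unfold mainTerm
  convert! h3 using 1
  rw [Complex.cpow_sub _ _ (div_ne_zero hz0 hpi), Complex.cpow_one]
  field_simp
  ring

lemma hasDerivAt_mainTerm_factor {z : ℂ} (hz : z ≠ 0) :
    HasDerivAt (fun z : ℂ => 1 / (2 * z) - (Real.pi : ℂ) ^ 2 / (4 * z ^ 2))
      (-(1 / (2 * z ^ 2)) + Real.pi ^ 2 / (2 * z ^ 3)) z := by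
  have h1 := (hasDerivAt_inv hz).const_mul (1 / 2 : ℂ)
  have h2 := ((hasDerivAt_inv hz).pow 2).const_mul ((Real.pi : ℂ) ^ 2 / 4)
  convert! h1.sub h2 using 1
  · ext w
    simp only [Pi.sub_apply, Pi.pow_apply]
    field_simp
  · norm_num
    field_simp
    ring

/-- The function `(n g - g') exp (n z)`, `g = mainTerm`, a primitive of `(n² g - g'') exp (n z)`. -/
noncomputable def mainTermPrimitive (n : ℂ) (z : ℂ) : ℂ :=
  mainTerm z * (n - (1 / (2 * z) - Real.pi ^ 2 / (4 * z ^ 2))) * Complex.exp (n * z)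

lemma hasDerivAt_mainTermPrimitive (n : ℂ) {z : ℂ} (hz : 0 < z.re) :
    HasDerivAt (mainTermPrimitive n)
      ((n ^ 2 * mainTerm z - mainTermDerivTwo z) * Complex.exp (n * z)) z := by
  have hz0 := ne_zero_of_re_pos hz
  have h1 := (hasDerivAt_mainTerm hz).mul ((hasDerivAt_const z n).sub
    (hasDerivAt_mainTerm_factor hz0))
  have h2 := h1.mul ((hasDerivAt_id z).const_mul n).cexp
  unfold mainTermPrimitive
  convert! h2 using 1
  simp only [Pi.sub_apply, Pi.mul_apply, id, mainTermDerivTwo]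
  field_simp
  ring

lemma integral_mainTerm_sub (n : ℂ) {y : ℝ} (hy : 0 < y) (c : ℝ) :
    ∫ θ in (-c)..c, (n ^ 2 * mainTerm (lineAt y θ) - mainTermDerivTwo (lineAt y θ)) *
      Complex.exp (n * lineAt y θ) =
      (mainTermPrimitive n (lineAt y c) - mainTermPrimitive n (lineAt y (-c))) / Complex.I := by
  have hl : ∀ θ : ℝ, HasDerivAt (fun θ : ℝ => lineAt y θ) Complex.I θ := fun θ => by
    have := ((Complex.ofRealCLM.hasDerivAt (x := θ)).mul_const Complex.I).const_add (y : ℂ)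
    simpa [lineAt] using this
  have hd : ∀ θ : ℝ, HasDerivAt (fun θ : ℝ => mainTermPrimitive n (lineAt y θ) / Complex.I)
      ((n ^ 2 * mainTerm (lineAt y θ) - mainTermDerivTwo (lineAt y θ)) *
        Complex.exp (n * lineAt y θ)) θ := fun θ => by
    have h := (hasDerivAt_mainTermPrimitive n (z := lineAt y θ) (by rwa [lineAt_re])).comp θ (hl θ)
    have h2 := h.div_const Complex.I
    rwa [mul_div_cancel_right₀ _ Complex.I_ne_zero] at h2
  have hc : Continuous fun θ : ℝ => lineAt y θ := by unfold lineAt; fun_prop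
  rw [intervalIntegral.integral_eq_sub_of_hasDerivAt (fun θ _ => hd θ), sub_div]
  refine Continuous.intervalIntegrable ?_ _ _
  exact ((continuous_const.mul (continuous_mainTerm_lineAt hy)).sub
    (continuous_mainTermDerivTwo_lineAt hy)).mul
    (Complex.continuous_exp.comp (continuous_const.mul hc))

lemma norm_exp_mul_lineAt (t y θ : ℝ) : ‖Complex.exp (t * lineAt y θ)‖ = Real.exp (t * y) := by
  rw [Complex.norm_exp]; simp [lineAt]

lemma continuous_overpartitionGF_lineAt {y : ℝ} (hy : 0 < y) :
    Continuous fun θ : ℝ => overpartitionGF (Complex.exp (-lineAt y θ)) := by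
  unfold overpartitionGF
  refine continuous_tsum (u := fun k => (overpartitionCount k : ℝ) * Real.exp (-y) ^ k)
    (fun k => by unfold lineAt; fun_prop)
    (summable_overpartitionCount (Real.exp_pos _).le (by simpa using hy)) fun k θ => ?_
  rw [norm_mul, norm_pow, Complex.norm_exp, Complex.norm_natCast, Complex.neg_re, lineAt_re]

lemma integral_overpartitionGF {y : ℝ} (hy : 0 < y) (n : ℕ) :
    ∫ θ in (-Real.pi)..Real.pi, overpartitionGF (Complex.exp (-lineAt y θ)) *
      Complex.exp (n * lineAt y θ) = 2 * Real.pi * overpartitionCount n := by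
  refine integral_powerSeries_mul_cexp (c := fun k => (overpartitionCount k : ℂ)) (y := y) ?_ n
  simpa using summable_overpartitionCount (Real.exp_pos (-y)).le (by simpa using hy)

/-- The parts of the line `Re z = y` far from the real axis contribute little to the inverse
Laplace transform. -/
lemma norm_integral_mainTermDerivTwo_sub_le {y c t e : ℝ} (hy : 0 < y) (hc : 0 < c)
    (he : ∀ θ, c ≤ |θ| → Real.pi ^ 2 / 4 * (1 / lineAt y θ).re ≤ e) :
    ‖(∫ θ : ℝ, mainTermDerivTwo (lineAt y θ) * Complex.exp (t * lineAt y θ)) -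
      ∫ θ in (-c)..c, mainTermDerivTwo (lineAt y θ) * Complex.exp (t * lineAt y θ)‖ ≤
      2 * (Real.exp e * (1 / 4 + 3 / c + 7 / c ^ 2) * c ^ (-(1 / 2) : ℝ) * Real.exp (t * y)) := by
  set F : ℝ → ℂ := fun θ => mainTermDerivTwo (lineAt y θ) * Complex.exp (t * lineAt y θ) with hF
  have hlc : Continuous fun θ : ℝ => lineAt y θ := by unfold lineAt; fun_prop
  have hFi : Integrable F := by
    refine (integrable_mainTermDerivTwo_lineAt hy).mul_bdd (c := Real.exp (t * y))
      (Continuous.aestronglyMeasurable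
        (Complex.continuous_exp.comp (continuous_const.mul hlc)))
      (Eventually.of_forall fun θ => (norm_exp_mul_lineAt t y θ).le)
  have hsplit : (∫ θ : ℝ, F θ) - ∫ θ in (-c)..c, F θ =
      (∫ θ in Ioi c, F (-θ)) + ∫ θ in Ioi c, F θ := by
    rw [integral_comp_neg_Ioi,
      ← intervalIntegral.integral_Iic_add_Ioi (b := -c) hFi.integrableOn hFi.integrableOn,
      ← intervalIntegral.integral_interval_add_Ioi (a := -c) (b := c) hFi.integrableOn
        hFi.integrableOn]
    ring
  set A := 1 / 2 * Real.exp e * (1 / 4 + 3 / c + 7 / c ^ 2) * Real.exp (t * y) with hA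
  have hA0 : 0 ≤ A := by positivity
  have hbound : ∀ θ, c ≤ |θ| → ‖F θ‖ ≤ A * |θ| ^ (-(3 / 2) : ℝ) := by
    intro θ hθ
    have h1 := abs_le_norm_lineAt y θ
    rw [hF, norm_mul, norm_exp_mul_lineAt]
    have h2 := norm_mainTermDerivTwo_le (lineAt y θ) hc (hθ.trans h1) (he θ hθ)
    have h3 : ‖lineAt y θ‖ ^ (-(3 / 2) : ℝ) ≤ |θ| ^ (-(3 / 2) : ℝ) :=
      Real.rpow_le_rpow_of_nonpos (hc.trans_le hθ) h1 (by norm_num)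
    calc _ ≤ 1 / 2 * Real.exp e * (1 / 4 + 3 / c + 7 / c ^ 2) * |θ| ^ (-(3 / 2) : ℝ) *
          Real.exp (t * y) := by
            refine mul_le_mul_of_nonneg_right (h2.trans ?_) (Real.exp_pos _).le
            gcongr
      _ = _ := by rw [hA]; ring
  have hint : ∫ θ in Ioi c, A * θ ^ (-(3 / 2) : ℝ) = A * (2 * c ^ (-(1 / 2) : ℝ)) := by
    rw [integral_const_mul, integral_Ioi_rpow_of_lt (by norm_num) hc]
    congr 1
    norm_num
    ring
  have hgi : IntegrableOn (fun θ => A * θ ^ (-(3 / 2) : ℝ)) (Ioi c) :=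
    (integrableOn_Ioi_rpow_of_lt (by norm_num) hc).const_mul A
  have n1 : ‖∫ θ in Ioi c, F (-θ)‖ ≤ A * (2 * c ^ (-(1 / 2) : ℝ)) := by
    rw [← hint]
    refine norm_integral_le_of_norm_le hgi ?_
    filter_upwards [ae_restrict_mem measurableSet_Ioi] with θ hθ
    have hθ' : c < θ := hθ
    have := hbound (-θ) (by rw [abs_neg, abs_of_pos (hc.trans hθ')]; exact hθ'.le)
    rwa [abs_neg, abs_of_pos (hc.trans hθ')] at this
  have n2 : ‖∫ θ in Ioi c, F θ‖ ≤ A * (2 * c ^ (-(1 / 2) : ℝ)) := by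
    rw [← hint]
    refine norm_integral_le_of_norm_le hgi ?_
    filter_upwards [ae_restrict_mem measurableSet_Ioi] with θ hθ
    have hθ' : c < θ := hθ
    have := hbound θ (by rw [abs_of_pos (hc.trans hθ')]; exact hθ'.le)
    rwa [abs_of_pos (hc.trans hθ')] at this
  rw [hsplit]
  refine (norm_add_le _ _).trans ((add_le_add n1 n2).trans (le_of_eq ?_))
  rw [hA]; ring

/-- The difference of the coefficient integral and the main term, in four pieces: the arc away from
`q = 1`, the approximation near `q = 1`, the boundary terms of the integration by parts and the
tails of the line integral. -/
lemma overpartitionCount_sub_eq {y c : ℝ} (hy : 0 < y) (n : ℕ) :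
    2 * Real.pi * ((n : ℂ) ^ 2 * overpartitionCount n - laplaceKernel n) =
      (n : ℂ) ^ 2 * ((∫ θ in (-Real.pi)..(-c), overpartitionGF (Complex.exp (-lineAt y θ)) *
        Complex.exp (n * lineAt y θ)) + ∫ θ in c..Real.pi,
        overpartitionGF (Complex.exp (-lineAt y θ)) * Complex.exp (n * lineAt y θ)) +
      (n : ℂ) ^ 2 * (∫ θ in (-c)..c, (overpartitionGF (Complex.exp (-lineAt y θ)) -
        mainTerm (lineAt y θ)) * Complex.exp (n * lineAt y θ)) +
      (mainTermPrimitive n (lineAt y c) - mainTermPrimitive n (lineAt y (-c))) / Complex.I -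
      ((∫ θ : ℝ, mainTermDerivTwo (lineAt y θ) * Complex.exp (n * lineAt y θ)) -
        ∫ θ in (-c)..c, mainTermDerivTwo (lineAt y θ) * Complex.exp (n * lineAt y θ)) := by
  have hlc : Continuous fun θ : ℝ => lineAt y θ := by unfold lineAt; fun_prop
  have hE : Continuous fun θ : ℝ => Complex.exp (n * lineAt y θ) :=
    Complex.continuous_exp.comp (continuous_const.mul hlc)
  have c1 : Continuous fun θ : ℝ => overpartitionGF (Complex.exp (-lineAt y θ)) *
      Complex.exp (n * lineAt y θ) := (continuous_overpartitionGF_lineAt hy).mul hE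
  have c2 : Continuous fun θ : ℝ => mainTerm (lineAt y θ) * Complex.exp (n * lineAt y θ) :=
    (continuous_mainTerm_lineAt hy).mul hE
  have c3 : Continuous fun θ : ℝ => mainTermDerivTwo (lineAt y θ) * Complex.exp (n * lineAt y θ) :=
    (continuous_mainTermDerivTwo_lineAt hy).mul hE
  have h1 := integral_overpartitionGF hy n
  have h2 := integral_mainTermDerivTwo_lineAt hy n
  have h3 := integral_mainTerm_sub n hy c
  have h4 : ∫ θ in (-c)..c, ((n : ℂ) ^ 2 * mainTerm (lineAt y θ) - mainTermDerivTwo (lineAt y θ)) *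
      Complex.exp (n * lineAt y θ) = (n : ℂ) ^ 2 * (∫ θ in (-c)..c, mainTerm (lineAt y θ) *
        Complex.exp (n * lineAt y θ)) - ∫ θ in (-c)..c, mainTermDerivTwo (lineAt y θ) *
        Complex.exp (n * lineAt y θ) := by
    rw [← intervalIntegral.integral_const_mul, ← intervalIntegral.integral_sub
      ((c2.intervalIntegrable _ _).const_mul _) (c3.intervalIntegrable _ _)]
    congr 1
    ext θ
    ring
  have h5 : ∫ θ in (-c)..c, (overpartitionGF (Complex.exp (-lineAt y θ)) -
        mainTerm (lineAt y θ)) * Complex.exp (n * lineAt y θ) =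
      (∫ θ in (-c)..c, overpartitionGF (Complex.exp (-lineAt y θ)) *
        Complex.exp (n * lineAt y θ)) - ∫ θ in (-c)..c, mainTerm (lineAt y θ) *
        Complex.exp (n * lineAt y θ) := by
    rw [← intervalIntegral.integral_sub (c1.intervalIntegrable _ _) (c2.intervalIntegrable _ _)]
    congr 1
    ext θ
    ring
  have h6 : ∫ θ in (-Real.pi)..Real.pi, overpartitionGF (Complex.exp (-lineAt y θ)) *
      Complex.exp (n * lineAt y θ) = (∫ θ in (-Real.pi)..(-c),
        overpartitionGF (Complex.exp (-lineAt y θ)) * Complex.exp (n * lineAt y θ)) +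
      (∫ θ in (-c)..c, overpartitionGF (Complex.exp (-lineAt y θ)) *
        Complex.exp (n * lineAt y θ)) + ∫ θ in c..Real.pi,
        overpartitionGF (Complex.exp (-lineAt y θ)) * Complex.exp (n * lineAt y θ) := by
    rw [intervalIntegral.integral_add_adjacent_intervals (c1.intervalIntegrable _ _)
      (c1.intervalIntegrable _ _), intervalIntegral.integral_add_adjacent_intervals
      (c1.intervalIntegrable _ _) (c1.intervalIntegrable _ _)]
  rw [h6] at h1
  rw [h4] at h3
  rw [h5, ← h3]
  push_cast at h2
  rw [h2]
  linear_combination -(n : ℂ) ^ 2 * h1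

lemma one_div_lineAt_re_le {y c θ : ℝ} (hy : 0 ≤ y) (hc : 0 < c) (hθ : c ≤ |θ|) :
    (1 / lineAt y θ).re ≤ y / c ^ 2 := by
  rw [one_div_lineAt_re]
  have h1 : c ^ 2 ≤ θ ^ 2 := sq_le_sq.2 (by rwa [abs_of_pos hc])
  exact div_le_div_of_nonneg_left hy (by positivity) (by nlinarith [sq_nonneg y])

lemma exp_neg_two_mul_re_lineAt_le {y θ : ℝ} (hy : 0 < y) (hy1 : y ≤ 7 / 100)
    (hθ : |θ| ≤ Real.pi * y) :
    Real.exp (-2 * Real.pi ^ 2 * (1 / lineAt y θ).re) ≤ 1 / 3 := by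
  have hp := Real.pi_gt_three
  rw [one_div_lineAt_re, neg_mul, neg_mul]
  refine exp_neg_le_third ?_
  have h1 : θ ^ 2 ≤ Real.pi ^ 2 * y ^ 2 := by
    rw [← mul_pow]; exact sq_le_sq.2 (by rwa [abs_of_pos (by positivity : 0 < Real.pi * y)])
  rw [mul_div_assoc', le_div_iff₀ (by positivity)]
  have h2 : y ^ 2 ≤ y * (7 / 100) := by nlinarith
  have h4 : Real.pi ^ 2 * y ^ 2 ≤ Real.pi ^ 2 * (y * (7 / 100)) := by gcongr
  have h5 : y * 9 ≤ y * Real.pi ^ 2 := by gcongr; nlinarith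
  linarith

lemma norm_mainTermPrimitive_le {n : ℕ} {s : ℝ} {z : ℂ} (hs : 25 ≤ s) (hn : s ^ 2 = n)
    (hz : 1 / ‖z‖ ≤ s / 4) (h1 : √(‖z‖ / Real.pi) ≤ 1) :
    ‖mainTermPrimitive n z‖ ≤
      s ^ 2 * (Real.exp (Real.pi ^ 2 / 4 * (1 / z).re) * ‖Complex.exp (n * z)‖) := by
  have hp0 := Real.pi_pos
  have hp := Real.pi_lt_d2
  rw [mainTermPrimitive, norm_mul, norm_mul, norm_mainTerm]
  have h5 : ‖(n : ℂ) - (1 / (2 * z) - Real.pi ^ 2 / (4 * z ^ 2))‖ ≤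
      s ^ 2 + (1 / 2 * (s / 4) + 3 * (s / 4) ^ 2) := by
    refine (norm_sub_le _ _).trans (add_le_add (by rw [Complex.norm_natCast, hn])
      ((norm_sub_le _ _).trans (add_le_add ?_ ?_)))
    · have : ‖1 / (2 * z)‖ = 1 / 2 * (1 / ‖z‖) := by
        rw [norm_div, norm_mul]; norm_num; ring
      rw [this]
      gcongr
    · have : ‖(Real.pi : ℂ) ^ 2 / (4 * z ^ 2)‖ = Real.pi ^ 2 / 4 * (1 / ‖z‖) ^ 2 := by
        rw [norm_div, norm_mul, norm_pow, norm_pow, Complex.norm_real,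
          Real.norm_of_nonneg hp0.le]; norm_num; field_simp
      rw [this]
      have h7 : Real.pi ^ 2 / 4 ≤ 3 := by nlinarith
      gcongr
  have h6 : s ^ 2 + (1 / 2 * (s / 4) + 3 * (s / 4) ^ 2) ≤ 2 * s ^ 2 := by nlinarith
  set E := Real.exp (Real.pi ^ 2 / 4 * (1 / z).re)
  calc _ ≤ 1 / 2 * 1 * E * (2 * s ^ 2) * ‖Complex.exp (n * z)‖ := by
        gcongr
        exact h5.trans h6
    _ = _ := by ring

lemma tail_factor_le {c s : ℝ} (hs : 25 ≤ s) (hc : 0 < c) (h : 1 / c ≤ s / 4) :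
    (1 / 4 + 3 / c + 7 / c ^ 2) * c ^ (-(1 / 2) : ℝ) ≤ s ^ 3 := by
  have hs0 : 0 < s := by linarith
  have h5 : c ^ (-(1 / 2) : ℝ) ≤ s := by
    have h1 : c ^ (-(1 / 2) : ℝ) = √(1 / c) := by
      rw [Real.rpow_neg hc.le, Real.sqrt_eq_rpow, one_div c, Real.inv_rpow hc.le]
    rw [h1]
    refine Real.sqrt_le_iff.2 ⟨hs0.le, h.trans ?_⟩
    nlinarith
  have h6 : 1 / 4 + 3 / c + 7 / c ^ 2 ≤ s ^ 2 := by
    have e1 : 3 / c = 3 * (1 / c) := by ring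
    have e2 : 7 / c ^ 2 = 7 * (1 / c) ^ 2 := by rw [one_div, inv_pow]; ring
    have : (1 / c) ^ 2 ≤ (s / 4) ^ 2 := by gcongr
    rw [e1, e2]
    nlinarith
  calc _ ≤ s ^ 2 * s := by gcongr
    _ = _ := by ring

lemma le_of_two_pi_mul_le {s E X : ℝ} (hs : 25 ≤ s) (hE : 0 < E)
    (h : 2 * Real.pi * X ≤
      s ^ 4 * (2 * Real.pi * E) + s ^ 4 * E + 2 * s ^ 2 * E + 2 * s ^ 3 * E) :
    X ≤ 2 * s ^ 4 * E := by
  have hp := Real.pi_gt_three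
  have hs0 : 0 < s := by linarith
  have h1 : 2 * s ^ 3 ≤ s ^ 4 := by
    rw [show s ^ 4 = s * s ^ 3 by ring]; gcongr; linarith
  have h2 : 2 * s ^ 2 ≤ s ^ 4 := by
    refine le_trans ?_ h1
    rw [show s ^ 3 = s * s ^ 2 by ring]
    nlinarith [sq_nonneg s]
  have h3 : 2 * s ^ 3 * E ≤ s ^ 4 * E := by gcongr
  have h4 : 2 * s ^ 2 * E ≤ s ^ 4 * E := by gcongr
  have h5 : 2 * 3 * (s ^ 4 * E) ≤ 2 * Real.pi * (s ^ 4 * E) := by gcongr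
  have h6 : 0 < s ^ 4 * E := by positivity
  have h7 : 2 * Real.pi * X ≤ 2 * Real.pi * (2 * s ^ 4 * E) := by linarith
  exact le_of_mul_le_mul_left h7 (by positivity)

set_option maxHeartbeats 1000000 in
/-- The approximation of `p̄(n)`; here `π²/(2√n)` is the half-width of the arc around `q = 1`, and
`y = π/(2√n)` is the saddle point of `exp (n y + π²/(4 y))`. -/
lemma abs_sub_laplaceKernel_le {n : ℕ} {s : ℝ} (hs : 25 ≤ s) (hn : s ^ 2 = n) :
    |(n : ℝ) ^ 2 * overpartitionCount n - laplaceKernel n| ≤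
      2 * s ^ 4 * Real.exp ((Real.pi - 3 / Real.pi) * s) := by
  have hp := Real.pi_gt_d2
  have hp' := Real.pi_lt_d2
  have hp0 := Real.pi_pos
  have hs0 : 0 < s := by linarith
  obtain ⟨y, hy⟩ : ∃ y, y = Real.pi / (2 * s) := ⟨_, rfl⟩
  have hy0 : 0 < y := by rw [hy]; positivity
  have hys : y * s = Real.pi / 2 := by rw [hy]; field_simp
  have hy1 : y ≤ 7 / 100 := by rw [hy, div_le_iff₀ (by positivity)]; linarith
  obtain ⟨c, hc⟩ : ∃ c, c = Real.pi * y := ⟨_, rfl⟩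
  have hc0 : 0 < c := by rw [hc]; positivity
  have hcs : c * s = Real.pi ^ 2 / 2 := by rw [hc, mul_assoc, hys]; ring
  have hcpi : c ≤ Real.pi := by rw [hc]; nlinarith
  have hcinv : 1 / c ≤ s / 4 := by
    rw [div_le_div_iff₀ hc0 (by norm_num)]
    nlinarith
  have hny : (n : ℝ) * y = Real.pi / 2 * s := by rw [← hn]; linear_combination s * hys
  have hay : Real.pi ^ 2 / (4 * y) = Real.pi / 2 * s := by rw [hy]; field_simp; ring
  have h32 : -(3 / 2) / y = -(3 / Real.pi) * s := by rw [hy]; field_simp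
  obtain ⟨E1, hE1⟩ : ∃ E, E = Real.exp (Real.pi / 2 * s) := ⟨_, rfl⟩
  obtain ⟨E2, hE2⟩ : ∃ E, E = Real.exp ((Real.pi - 3 / Real.pi) * s) := ⟨_, rfl⟩
  obtain ⟨E3, hE3⟩ : ∃ E, E = Real.exp (1 / (2 * Real.pi) * s) := ⟨_, rfl⟩
  have hE1p : 0 < E1 := hE1 ▸ Real.exp_pos _
  have hE3p : 0 < E3 := hE3 ▸ Real.exp_pos _
  have hE2p : 0 < E2 := hE2 ▸ Real.exp_pos _
  have hE31 : 1 ≤ E3 := hE3 ▸ Real.one_le_exp (by positivity)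
  have hEE : E3 * E1 ≤ E2 := by
    rw [hE1, hE2, hE3, ← Real.exp_add, ← add_mul]
    refine Real.exp_le_exp.2 (mul_le_mul_of_nonneg_right ?_ hs0.le)
    have h1 : 1 / Real.pi ≤ 1 / 3.14 := one_div_le_one_div_of_le (by norm_num) hp.le
    have h2 : 1 / (2 * Real.pi) = 1 / 2 * (1 / Real.pi) := by field_simp
    have h3 : 3 / Real.pi = 3 * (1 / Real.pi) := by ring
    rw [h2, h3]
    norm_num at h1 ⊢
    linarith
  have hexpn : ∀ θ : ℝ, ‖Complex.exp (n * lineAt y θ)‖ = E1 := fun θ => by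
    have := norm_exp_mul_lineAt n y θ
    rw [hny, ← hE1] at this
    exact_mod_cast this
  -- the arc away from `q = 1`
  have hminor : ∀ θ : ℝ, c ≤ |θ| → |θ| ≤ Real.pi →
      ‖overpartitionGF (Complex.exp (-lineAt y θ)) * Complex.exp (n * lineAt y θ)‖ ≤ E2 := by
    intro θ h1 h2
    have h := norm_overpartitionGF_minor_le hy0 hy1 (by rwa [hc] at h1) h2
    rw [norm_mul, hexpn]
    have hsq : √(y / Real.pi) ≤ 1 := by
      refine Real.sqrt_le_iff.2 ⟨zero_le_one, ?_⟩
      rw [one_pow, div_le_one hp0]; linarith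
    calc _ ≤ √(y / Real.pi) * Real.exp (Real.pi ^ 2 / (4 * y)) * Real.exp (-(3 / 2) / y) * E1 :=
          mul_le_mul_of_nonneg_right h hE1p.le
      _ ≤ 1 * Real.exp (Real.pi ^ 2 / (4 * y)) * Real.exp (-(3 / 2) / y) * E1 := by gcongr
      _ = E2 := by
        rw [hay, h32, one_mul, hE1, hE2, ← Real.exp_add, ← Real.exp_add]
        congr 1; ring
  have b1 : ‖∫ θ in (-Real.pi)..(-c), overpartitionGF (Complex.exp (-lineAt y θ)) *
      Complex.exp (n * lineAt y θ)‖ ≤ E2 * Real.pi := by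
    refine (intervalIntegral.norm_integral_le_of_norm_le_const (C := E2) fun θ hθ => ?_).trans ?_
    · rw [uIoc_of_le (by linarith)] at hθ
      have h1 := hθ.1
      have h2 := hθ.2
      refine hminor θ ?_ ?_
      · rw [abs_of_neg (by linarith)]; linarith
      · rw [abs_of_neg (by linarith)]; linarith
    · rw [abs_of_nonneg (by linarith)]
      gcongr
      linarith
  have b2 : ‖∫ θ in c..Real.pi, overpartitionGF (Complex.exp (-lineAt y θ)) *
      Complex.exp (n * lineAt y θ)‖ ≤ E2 * Real.pi := by
    refine (intervalIntegral.norm_integral_le_of_norm_le_const (C := E2) fun θ hθ => ?_).trans ?_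
    · rw [uIoc_of_le (by linarith)] at hθ
      have h1 := hθ.1
      have h2 := hθ.2
      refine hminor θ ?_ ?_
      · rw [abs_of_pos (by linarith)]; linarith
      · rw [abs_of_pos (by linarith)]; linarith
    · rw [abs_of_nonneg (by linarith)]
      gcongr
      linarith
  have hnormle : ∀ θ : ℝ, |θ| ≤ c → √(‖lineAt y θ‖ / Real.pi) ≤ 1 := by
    intro θ hθ
    refine Real.sqrt_le_iff.2 ⟨zero_le_one, ?_⟩
    rw [one_pow, div_le_one hp0]
    have : ‖lineAt y θ‖ ≤ |y| + |θ| := by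
      have := Complex.norm_le_abs_re_add_abs_im (lineAt y θ)
      rwa [lineAt_re, lineAt_im] at this
    rw [abs_of_pos hy0] at this
    have : c ≤ 1 := by rw [hc]; nlinarith
    linarith
  -- the arc around `q = 1`
  have b3 : ‖∫ θ in (-c)..c, (overpartitionGF (Complex.exp (-lineAt y θ)) -
        mainTerm (lineAt y θ)) * Complex.exp (n * lineAt y θ)‖ ≤ E1 := by
    have h : ∀ θ ∈ uIoc (-c) c, ‖(overpartitionGF (Complex.exp (-lineAt y θ)) -
        mainTerm (lineAt y θ)) * Complex.exp (n * lineAt y θ)‖ ≤ 3 / 2 * E1 := by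
      intro θ hθ
      rw [uIoc_of_le (by linarith)] at hθ
      have hθc : |θ| ≤ c := abs_le.2 ⟨hθ.1.le, hθ.2⟩
      rw [norm_mul, hexpn]
      refine mul_le_mul_of_nonneg_right ?_ hE1p.le
      refine (norm_overpartitionGF_sub_mainTerm_le (by rwa [lineAt_re]) ?_).trans ?_
      · exact exp_neg_two_mul_re_lineAt_le hy0 hy1 (hc ▸ hθc)
      · have := hnormle θ hθc
        linarith
    refine (intervalIntegral.norm_integral_le_of_norm_le_const h).trans ?_
    rw [abs_of_pos (by linarith)]
    have : c ≤ 0.23 := by rw [hc]; nlinarith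
    nlinarith
  have he : ∀ θ : ℝ, c ≤ |θ| → Real.pi ^ 2 / 4 * (1 / lineAt y θ).re ≤ 1 / (2 * Real.pi) * s := by
    intro θ hθ
    have h1 := one_div_lineAt_re_le hy0.le hc0 hθ
    calc _ ≤ Real.pi ^ 2 / 4 * (y / c ^ 2) := mul_le_mul_of_nonneg_left h1 (by positivity)
      _ = _ := by rw [hc, hy]; field_simp; ring
  -- the boundary terms
  have b4 : ∀ θ : ℝ, |θ| = c → ‖mainTermPrimitive n (lineAt y θ)‖ ≤ s ^ 2 * (E3 * E1) := by
    intro θ hθ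
    have h1 : Real.exp (Real.pi ^ 2 / 4 * (1 / lineAt y θ).re) ≤ E3 :=
      hE3 ▸ Real.exp_le_exp.2 (he θ hθ.ge)
    have h3 : c ≤ ‖lineAt y θ‖ := hθ ▸ abs_le_norm_lineAt y θ
    have h := norm_mainTermPrimitive_le hs hn ((one_div_le_one_div_of_le hc0 h3).trans hcinv)
      (hnormle θ hθ.le)
    rw [hexpn] at h
    refine h.trans ?_
    gcongr
  -- the tails
  have b5 : ‖(∫ θ : ℝ, mainTermDerivTwo (lineAt y θ) * Complex.exp (n * lineAt y θ)) -
      ∫ θ in (-c)..c, mainTermDerivTwo (lineAt y θ) * Complex.exp (n * lineAt y θ)‖ ≤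
      2 * s ^ 3 * (E3 * E1) := by
    have h := norm_integral_mainTermDerivTwo_sub_le (t := n) hy0 hc0 he
    rw [hny, ← hE1, ← hE3] at h
    push_cast at h
    refine h.trans ?_
    have h4 := tail_factor_le hs hc0 hcinv
    calc _ = 2 * (E3 * ((1 / 4 + 3 / c + 7 / c ^ 2) * c ^ (-(1 / 2) : ℝ)) * E1) := by ring
      _ ≤ 2 * (E3 * s ^ 3 * E1) := by gcongr
      _ = _ := by ring
  have key := overpartitionCount_sub_eq (c := c) hy0 n
  have hnorm := congrArg norm key
  have hlhs : ‖2 * (Real.pi : ℂ) * ((n : ℂ) ^ 2 * overpartitionCount n - laplaceKernel n)‖ =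
      2 * Real.pi * |(n : ℝ) ^ 2 * overpartitionCount n - laplaceKernel n| := by
    rw [← Real.norm_eq_abs, ← Complex.norm_real, norm_mul, norm_mul, Complex.norm_real,
      Real.norm_of_nonneg hp0.le]
    norm_num
  rw [hlhs] at hnorm
  set I1 := ∫ θ in (-Real.pi)..(-c), overpartitionGF (Complex.exp (-lineAt y θ)) *
      Complex.exp (n * lineAt y θ)
  set I2 := ∫ θ in c..Real.pi, overpartitionGF (Complex.exp (-lineAt y θ)) *
      Complex.exp (n * lineAt y θ)
  set I3 := ∫ θ in (-c)..c, (overpartitionGF (Complex.exp (-lineAt y θ)) -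
        mainTerm (lineAt y θ)) * Complex.exp (n * lineAt y θ)
  set I4 := (∫ θ : ℝ, mainTermDerivTwo (lineAt y θ) * Complex.exp (n * lineAt y θ)) -
      ∫ θ in (-c)..c, mainTermDerivTwo (lineAt y θ) * Complex.exp (n * lineAt y θ)
  set P1 := mainTermPrimitive n (lineAt y c)
  set P2 := mainTermPrimitive n (lineAt y (-c))
  have hP1 : ‖P1‖ ≤ s ^ 2 * (E3 * E1) := b4 c (abs_of_pos hc0)
  have hP2 : ‖P2‖ ≤ s ^ 2 * (E3 * E1) := b4 (-c) (by rw [abs_neg, abs_of_pos hc0])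
  have hnn : ‖(n : ℂ) ^ 2‖ = s ^ 4 := by
    rw [norm_pow, Complex.norm_natCast, ← hn]; ring
  have t1 : ‖(n : ℂ) ^ 2 * (I1 + I2)‖ ≤ s ^ 4 * (2 * Real.pi * E2) := by
    rw [norm_mul, hnn]
    have := norm_add_le I1 I2
    gcongr
    linarith
  have t2 : ‖(n : ℂ) ^ 2 * I3‖ ≤ s ^ 4 * E2 := by
    rw [norm_mul, hnn]
    have : E1 ≤ E2 := (le_mul_of_one_le_left hE1p.le hE31).trans hEE
    gcongr
    linarith
  have t3 : ‖(P1 - P2) / Complex.I‖ ≤ 2 * s ^ 2 * E2 := by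
    rw [norm_div, Complex.norm_I, div_one]
    have := norm_sub_le P1 P2
    have : s ^ 2 * (E3 * E1) ≤ s ^ 2 * E2 := by gcongr
    linarith
  have t4 : ‖I4‖ ≤ 2 * s ^ 3 * E2 := b5.trans (by gcongr)
  have htot : 2 * Real.pi * |(n : ℝ) ^ 2 * overpartitionCount n - laplaceKernel n| ≤
      s ^ 4 * (2 * Real.pi * E2) + s ^ 4 * E2 + 2 * s ^ 2 * E2 + 2 * s ^ 3 * E2 := by
    rw [hnorm]
    refine (norm_sub_le _ _).trans (add_le_add ((norm_add_le _ _).trans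
      (add_le_add ((norm_add_le _ _).trans (add_le_add t1 t2)) t3)) t4)
  rw [← hE2]
  exact le_of_two_pi_mul_le hs hE2p htot

end

/-! ### Log-concavity for large arguments -/

/-- The exponent `3 / π` is the saving of the error term over `exp (π s)`; the power of `s` bounds
the polynomial factors left to absorb. It suffices that `3.6 s ≤ exp (0.19 s)`, as
`540 ≤ 3.6 ^ 5` and `5 · 0.19 = 0.95 ≤ 3 / π`. -/
lemma mul_pow_five_le_exp {s : ℝ} (hs : 25 ≤ s) : 540 * s ^ 5 ≤ Real.exp (3 / Real.pi * s) := by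
  have hp := Real.pi_lt_d2
  have hp0 := Real.pi_pos
  have h1 : 0.95 * s ≤ 3 / Real.pi * s := by
    have : (0.95 : ℝ) ≤ 3 / Real.pi := by rw [le_div_iff₀ hp0]; linarith
    gcongr
  refine le_trans ?_ (Real.exp_le_exp.2 h1)
  have h2 : (3.6 * s) ≤ Real.exp (0.19 * s) := by
    have e1 : Real.exp (0.19 * s) =
        Real.exp 1 ^ 4 * Real.exp 0.75 * Real.exp (0.19 * (s - 25)) := by
      rw [← Real.exp_nat_mul, ← Real.exp_add, ← Real.exp_add]; congr 1; push_cast; ring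
    have e2 := Real.exp_one_gt_d9
    have e3 := Real.quadratic_le_exp_of_nonneg (x := 0.75) (by norm_num)
    have e4 := Real.add_one_le_exp (0.19 * (s - 25))
    have e5 : (54 : ℝ) ≤ Real.exp 1 ^ 4 := by
      have : (2.718 : ℝ) ^ 4 ≤ Real.exp 1 ^ 4 := by gcongr; linarith
      norm_num at this ⊢
      linarith
    rw [e1]
    have e6 : (54 : ℝ) * 2 ≤ Real.exp 1 ^ 4 * Real.exp 0.75 := by
      gcongr
      norm_num at e3 ⊢
      linarith
    have e7 : (54 : ℝ) * 2 * (0.19 * (s - 25) + 1) ≤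
        Real.exp 1 ^ 4 * Real.exp 0.75 * Real.exp (0.19 * (s - 25)) := by
      gcongr
    linarith
  have e8 : Real.exp (0.95 * s) = Real.exp (0.19 * s) ^ 5 := by
    rw [← Real.exp_nat_mul]; congr 1; push_cast; ring
  rw [e8]
  calc 540 * s ^ 5 ≤ (3.6 * s) ^ 5 := by rw [mul_pow]; gcongr; norm_num
    _ ≤ _ := by gcongr

/-- The leading term of `8 n p̄(n)` in the variable `s = √n`. -/
noncomputable def leadingTerm (s : ℝ) : ℝ := Real.exp (Real.pi * s) * (1 - 1 / (Real.pi * s))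

lemma one_div_pi_mul_le {s : ℝ} (hs : 3 ≤ s) : 1 / (Real.pi * s) ≤ 1 / 9 := by
  have := Real.pi_gt_three
  exact one_div_le_one_div_of_le (by norm_num) (by nlinarith)

lemma leadingTerm_pos {s : ℝ} (hs : 3 ≤ s) : 0 < leadingTerm s := by
  have := one_div_pi_mul_le hs
  exact mul_pos (Real.exp_pos _) (by linarith)

lemma laplaceKernel_eq {n : ℕ} {s : ℝ} (hs : 0 < s) (hn : s ^ 2 = n) :
    laplaceKernel n = s ^ 2 / 8 * leadingTerm s -
      Real.exp (-(Real.pi * s)) * (s ^ 2 + s / Real.pi) / 8 := by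
  have hp := Real.pi_ne_zero
  rw [laplaceKernel, ← hn, Real.sqrt_sq hs.le, leadingTerm, Real.sinh_eq, Real.cosh_eq]
  field_simp
  ring

/-- The relative error of the leading term is small compared to `n^(-3/2)`, the order of the
logarithmic second difference of `exp (π √n)`. -/
lemma abs_overpartitionCount_sub_le {n : ℕ} {s : ℝ} (hs : 25 ≤ s) (hn : s ^ 2 = n) :
    |8 * s ^ 2 * overpartitionCount n - leadingTerm s| ≤ 1 / (20 * s ^ 3) * leadingTerm s := by
  have hs0 : 0 < s := by linarith
  have hp := Real.pi_gt_three
  have hp0 := Real.pi_pos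
  have h := abs_sub_laplaceKernel_le hs hn
  rw [laplaceKernel_eq hs0 hn, ← hn] at h
  obtain ⟨E, hE⟩ : ∃ E, E = Real.exp ((Real.pi - 3 / Real.pi) * s) := ⟨_, rfl⟩
  rw [← hE] at h
  have hE1 : 1 ≤ E := by
    rw [hE]
    refine Real.one_le_exp (mul_nonneg (sub_nonneg.2 ?_) hs0.le)
    rw [div_le_iff₀ hp0]; nlinarith
  obtain ⟨x, hx⟩ : ∃ x, x = Real.exp (-(Real.pi * s)) * (s ^ 2 + s / Real.pi) / 8 := ⟨_, rfl⟩
  rw [← hx] at h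
  have hx0 : 0 ≤ x := by rw [hx]; positivity
  have hx1 : x ≤ s ^ 4 * E := by
    have h1 : Real.exp (-(Real.pi * s)) ≤ 1 := by
      rw [Real.exp_le_one_iff]; nlinarith
    have h2 : s / Real.pi ≤ s ^ 2 := by
      rw [div_le_iff₀ hp0]; nlinarith
    have h3 : s ^ 2 ≤ s ^ 4 := pow_le_pow_right₀ (by linarith) (by norm_num)
    have h4 : s ^ 4 * 1 ≤ s ^ 4 * E := by gcongr
    have h5 : x ≤ 1 * (s ^ 2 + s ^ 2) / 8 := by rw [hx]; gcongr
    linarith [pow_pos hs0 4]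
  have h6 : |(s ^ 2) ^ 2 * overpartitionCount n - s ^ 2 / 8 * leadingTerm s| ≤ 3 * s ^ 4 * E := by
    rw [abs_le] at h ⊢
    constructor <;> linarith [h.1, h.2]
  have h7 : (8 : ℝ) / 9 * Real.exp (Real.pi * s) ≤ leadingTerm s := by
    have := one_div_pi_mul_le (s := s) (by linarith)
    rw [leadingTerm, mul_comm]
    gcongr
    linarith
  have h8 : E * (540 * s ^ 5) ≤ Real.exp (Real.pi * s) := by
    calc E * (540 * s ^ 5) ≤ E * Real.exp (3 / Real.pi * s) := by
          gcongr
          exact mul_pow_five_le_exp hs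
      _ = _ := by rw [hE, ← Real.exp_add]; congr 1; ring
  have h9 : 24 * s ^ 2 * E ≤ 1 / (20 * s ^ 3) * leadingTerm s := by
    rw [one_div_mul_eq_div, le_div_iff₀ (by positivity)]
    calc 24 * s ^ 2 * E * (20 * s ^ 3) = 8 / 9 * (E * (540 * s ^ 5)) := by ring
      _ ≤ 8 / 9 * Real.exp (Real.pi * s) := by gcongr
      _ ≤ _ := h7
  refine le_trans ?_ h9
  have h10 : (s ^ 2) ^ 2 * overpartitionCount n - s ^ 2 / 8 * leadingTerm s =
      s ^ 2 / 8 * (8 * s ^ 2 * overpartitionCount n - leadingTerm s) := by ring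
  rw [h10, abs_mul, abs_of_pos (by positivity)] at h6
  have h11 : s ^ 2 / 8 * |8 * s ^ 2 * overpartitionCount n - leadingTerm s| ≤
      s ^ 2 / 8 * (24 * s ^ 2 * E) := by linarith
  exact le_of_mul_le_mul_left h11 (by positivity)

/-- The second difference of `√n` at `n = s ^ 2`. -/
lemma sqrt_add_sqrt_le {s a b : ℝ} (hs : 1 ≤ s)
    (ha : a ^ 2 = s ^ 2 - 1) (hb : b ^ 2 = s ^ 2 + 1) : a + b ≤ 2 * s - 1 / (4 * s ^ 3) := by
  have hs0 : 0 < s := by linarith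
  have h1 : a * b ≤ s ^ 2 - 1 / (2 * s ^ 2) := by
    have h2 : 0 ≤ s ^ 2 - 1 / (2 * s ^ 2) := by
      rw [sub_nonneg, div_le_iff₀ (by positivity)]
      nlinarith
    refine abs_le_of_sq_le_sq' ?_ h2 |>.2
    have h3 : (s ^ 2 - 1 / (2 * s ^ 2)) ^ 2 = s ^ 4 - 1 + (1 / (2 * s ^ 2)) ^ 2 := by
      field_simp; ring
    rw [h3, mul_pow, ha, hb]
    nlinarith [sq_nonneg (1 / (2 * s ^ 2))]
  have h4 : 0 ≤ 2 * s - 1 / (4 * s ^ 3) := by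
    rw [sub_nonneg, div_le_iff₀ (by positivity)]
    have : 1 ≤ s ^ 4 := one_le_pow₀ hs
    nlinarith
  refine abs_le_of_sq_le_sq' ?_ h4 |>.2
  have h5 : (2 * s - 1 / (4 * s ^ 3)) ^ 2 =
      4 * s ^ 2 - 2 * (1 / (2 * s ^ 2)) + (1 / (4 * s ^ 3)) ^ 2 := by
    field_simp; ring
  rw [h5]
  nlinarith [sq_nonneg (1 / (4 * s ^ 3))]

/-- Log-concavity of the leading term, with `a = √(n - 1)`, `s = √n`, `b = √(n + 1)`; the constant
`3 / 4` is a lower bound for `π / 4`, which `sqrt_add_sqrt_le` provides. -/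
lemma leadingTerm_mul_le {s a b : ℝ} (hs : 4 ≤ s) (ha0 : 3 ≤ a) (hb0 : 3 ≤ b)
    (ha : a ^ 2 = s ^ 2 - 1) (hb : b ^ 2 = s ^ 2 + 1) :
    leadingTerm a * leadingTerm b * (1 + 3 / 4 * (1 / s ^ 3)) ≤ leadingTerm s ^ 2 := by
  have hp := Real.pi_gt_three
  have hs0 : 0 < s := by linarith
  have h1 := sqrt_add_sqrt_le (by linarith) ha hb
  have hexp : Real.exp (Real.pi * a) * Real.exp (Real.pi * b) * (1 + 3 / 4 * (1 / s ^ 3)) ≤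
      Real.exp (Real.pi * s) ^ 2 := by
    have h2 := Real.add_one_le_exp (3 / 4 * (1 / s ^ 3))
    calc _ ≤ Real.exp (Real.pi * a) * Real.exp (Real.pi * b) * Real.exp (3 / 4 * (1 / s ^ 3)) := by
          gcongr
          linarith
      _ ≤ _ := by
        rw [← Real.exp_add, ← Real.exp_add, ← Real.exp_nat_mul]
        refine Real.exp_le_exp.2 ?_
        have h3 : 1 / (4 * s ^ 3) = 1 / 4 * (1 / s ^ 3) := by field_simp
        rw [h3] at h1
        have h4 : 0 < 1 / s ^ 3 := by positivity
        push_cast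
        nlinarith
  -- `1 - 1 / (π √n)` is concave in `n`
  have hlin : (1 - 1 / (Real.pi * a)) * (1 - 1 / (Real.pi * b)) ≤ (1 - 1 / (Real.pi * s)) ^ 2 := by
    have i1 := one_div_pi_mul_le ha0
    have i2 := one_div_pi_mul_le hb0
    have i3 := one_div_pi_mul_le (s := s) (by linarith)
    have ha1 : 0 < a := by linarith
    have hb1 : 0 < b := by linarith
    have h5 : 2 * (1 / (Real.pi * s)) ≤ 1 / (Real.pi * a) + 1 / (Real.pi * b) := by
      have h6 : a + b ≤ 2 * s := h1.trans (by
        have : 0 < 1 / (4 * s ^ 3) := by positivity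
        linarith)
      have h7 : 1 / (Real.pi * a) + 1 / (Real.pi * b) = (a + b) / (Real.pi * (a * b)) := by
        field_simp
        ring
      rw [h7, mul_one_div, div_le_div_iff₀ (by positivity) (by positivity)]
      have h8 : 2 * (a * b) ≤ (a + b) * s := by nlinarith [sq_nonneg (a - b)]
      nlinarith
    nlinarith [sq_nonneg (1 / (Real.pi * a) - 1 / (Real.pi * b))]
  have j1 := one_div_pi_mul_le ha0
  have j2 := one_div_pi_mul_le hb0
  have j3 : 0 ≤ (1 - 1 / (Real.pi * a)) * (1 - 1 / (Real.pi * b)) :=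
    mul_nonneg (by linarith) (by linarith)
  simp only [leadingTerm]
  calc _ = Real.exp (Real.pi * a) * Real.exp (Real.pi * b) * (1 + 3 / 4 * (1 / s ^ 3)) *
        ((1 - 1 / (Real.pi * a)) * (1 - 1 / (Real.pi * b))) := by ring
    _ ≤ Real.exp (Real.pi * s) ^ 2 * (1 - 1 / (Real.pi * s)) ^ 2 := by gcongr
    _ = _ := by ring

/-- If `8 a² p` and `8 b² r` are at most slightly larger than `A` and `B`, and `8 s² q` is at
least slightly smaller than `S`, then a gap between `A B` and `S ^ 2` gives `p r < q ^ 2`: the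
relative errors `0.05 + 2 · 0.06 + 2 · 0.05` sum to less than `3 / 4`. -/
lemma mul_lt_sq_of_asymptotic {p q r a s b A S B h : ℝ} (hh0 : 0 < h) (hh1 : h ≤ 1 / 100)
    (hp : 0 ≤ p) (hr : 0 ≤ r) (hs : 0 < s)
    (hA : 0 < A) (hS : 0 < S) (hB : 0 < B)
    (u1 : 8 * a ^ 2 * p ≤ (1 + 6 / 100 * h) * A) (u2 : (1 - 5 / 100 * h) * S ≤ 8 * s ^ 2 * q)
    (u3 : 8 * b ^ 2 * r ≤ (1 + 6 / 100 * h) * B)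
    (hfac : s ^ 4 ≤ (1 + 5 / 100 * h) * (a ^ 2 * b ^ 2))
    (hmul : A * B * (1 + 3 / 4 * h) ≤ S ^ 2) : p * r < q ^ 2 := by
  have hAB : 0 < A * B := mul_pos hA hB
  have hS0 : 0 ≤ (1 - 5 / 100 * h) * S := mul_nonneg (by linarith) hS.le
  have hpr : 0 ≤ p * r := mul_nonneg hp hr
  have hnum : (1 + 5 / 100 * h) * (1 + 6 / 100 * h) ^ 2 <
      (1 - 5 / 100 * h) ^ 2 * (1 + 3 / 4 * h) := by
    nlinarith [pow_pos hh0 2, pow_pos hh0 3]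
  have h1 : (8 * a ^ 2 * p) * (8 * b ^ 2 * r) ≤
      ((1 + 6 / 100 * h) * A) * ((1 + 6 / 100 * h) * B) :=
    mul_le_mul u1 u3 (by positivity) (by positivity)
  have key : (p * r) * (64 * s ^ 4) < q ^ 2 * (64 * s ^ 4) := by
    calc (p * r) * (64 * s ^ 4)
        ≤ (p * r) * (64 * ((1 + 5 / 100 * h) * (a ^ 2 * b ^ 2))) :=
          mul_le_mul_of_nonneg_left (by linarith) hpr
      _ = (1 + 5 / 100 * h) * ((8 * a ^ 2 * p) * (8 * b ^ 2 * r)) := by ring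
      _ ≤ (1 + 5 / 100 * h) * (((1 + 6 / 100 * h) * A) * ((1 + 6 / 100 * h) * B)) :=
          mul_le_mul_of_nonneg_left h1 (by positivity)
      _ = ((1 + 5 / 100 * h) * (1 + 6 / 100 * h) ^ 2) * (A * B) := by ring
      _ < ((1 - 5 / 100 * h) ^ 2 * (1 + 3 / 4 * h)) * (A * B) :=
          mul_lt_mul_of_pos_right hnum hAB
      _ = (1 - 5 / 100 * h) ^ 2 * (A * B * (1 + 3 / 4 * h)) := by ring
      _ ≤ (1 - 5 / 100 * h) ^ 2 * S ^ 2 := mul_le_mul_of_nonneg_left hmul (sq_nonneg _)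
      _ = ((1 - 5 / 100 * h) * S) ^ 2 := by ring
      _ ≤ (8 * s ^ 2 * q) ^ 2 := pow_le_pow_left₀ hS0 u2 2
      _ = _ := by ring
  exact lt_of_mul_lt_mul_right key (by positivity)

lemma logConcave_of_ge {k : ℕ} (hk : 625 ≤ k) :
    overpartitionCount k * overpartitionCount (k + 2) < overpartitionCount (k + 1) ^ 2 := by
  obtain ⟨a, ha⟩ : ∃ a, a = √(k : ℝ) := ⟨_, rfl⟩
  obtain ⟨s, hs⟩ : ∃ s, s = √((k + 1 : ℕ) : ℝ) := ⟨_, rfl⟩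
  obtain ⟨b, hb⟩ : ∃ b, b = √((k + 2 : ℕ) : ℝ) := ⟨_, rfl⟩
  have hk' : (625 : ℝ) ≤ k := by exact_mod_cast hk
  have ha2 : a ^ 2 = k := by rw [ha, Real.sq_sqrt (by positivity)]
  have hs2 : s ^ 2 = (k + 1 : ℕ) := by rw [hs, Real.sq_sqrt (by positivity)]
  have hb2 : b ^ 2 = (k + 2 : ℕ) := by rw [hb, Real.sq_sqrt (by positivity)]
  have ha25 : 25 ≤ a := by rw [ha]; exact Real.le_sqrt_of_sq_le (by linarith)
  have has : a ≤ s := by rw [ha, hs]; exact Real.sqrt_le_sqrt (by push_cast; linarith)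
  have hsb : s ≤ b := by rw [hs, hb]; exact Real.sqrt_le_sqrt (by push_cast; linarith)
  have ha0 : 0 < a := by linarith
  have hs0 : 0 < s := by linarith
  have hb0 : 0 < b := by linarith
  have e1 := abs_overpartitionCount_sub_le ha25 ha2
  have e2 := abs_overpartitionCount_sub_le (ha25.trans has) hs2
  have e3 := abs_overpartitionCount_sub_le (ha25.trans (has.trans hsb)) hb2
  push_cast at hs2 hb2
  have hmul := leadingTerm_mul_le (s := s) (a := a) (b := b) (by linarith) (by linarith)
    (by linarith) (by linarith) (by linarith)
  have La := leadingTerm_pos (s := a) (by linarith)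
  have Ls := leadingTerm_pos (s := s) (by linarith)
  have Lb := leadingTerm_pos (s := b) (by linarith)
  obtain ⟨h, hh⟩ : ∃ h, h = 1 / s ^ 3 := ⟨_, rfl⟩
  rw [← hh] at hmul
  have hh0 : 0 < h := by rw [hh]; positivity
  have hh1 : h ≤ 1 / 100 := by
    rw [hh]
    refine one_div_le_one_div_of_le (by norm_num) ?_
    have : (25 : ℝ) ^ 3 ≤ s ^ 3 := by gcongr; linarith
    linarith
  have da : 1 / (20 * a ^ 3) ≤ 6 / 100 * h := by
    have h1 : 0.99 * s ≤ a := by nlinarith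
    have h2 : (0.99 * s) ^ 3 ≤ a ^ 3 := by gcongr
    rw [hh, mul_one_div, div_le_div_iff₀ (by positivity) (by positivity)]
    have : 0 < s ^ 3 := by positivity
    rw [mul_pow] at h2
    norm_num at h2
    linarith
  have ds : 1 / (20 * s ^ 3) = 5 / 100 * h := by rw [hh]; field_simp; norm_num
  have db : 1 / (20 * b ^ 3) ≤ 6 / 100 * h := by
    have h2 : s ^ 3 ≤ b ^ 3 := by gcongr
    rw [hh, mul_one_div, div_le_div_iff₀ (by positivity) (by positivity)]
    have : 0 < s ^ 3 := by positivity
    linarith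
  have u1 : 8 * a ^ 2 * overpartitionCount k ≤ (1 + 6 / 100 * h) * leadingTerm a := by
    have := mul_le_mul_of_nonneg_right da La.le
    linarith [(abs_le.1 e1).2]
  have u3 : 8 * b ^ 2 * overpartitionCount (k + 2) ≤ (1 + 6 / 100 * h) * leadingTerm b := by
    have := mul_le_mul_of_nonneg_right db Lb.le
    linarith [(abs_le.1 e3).2]
  have u2 : (1 - 5 / 100 * h) * leadingTerm s ≤ 8 * s ^ 2 * overpartitionCount (k + 1) := by
    rw [ds] at e2
    linarith [(abs_le.1 e2).1]
  -- the factor `n²/(n² - 1)` coming from the denominators `8 n`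
  have hfac : s ^ 4 ≤ (1 + 5 / 100 * h) * (a ^ 2 * b ^ 2) := by
    have h1 : a ^ 2 * b ^ 2 = s ^ 4 - 1 := by
      have : s ^ 4 = (s ^ 2) ^ 2 := by ring
      rw [this, hs2, ha2, hb2]; ring
    rw [h1]
    have h2 : h * s ^ 4 = s := by rw [hh]; field_simp
    nlinarith
  exact_mod_cast mul_lt_sq_of_asymptotic hh0 hh1 (Nat.cast_nonneg _) (Nat.cast_nonneg _) hs0
    La Ls Lb u1 u2 u3 hfac hmul

/-! ### Consequences of log-concavity -/

lemma logConcave {k : ℕ} (hk : 2 ≤ k) :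
    overpartitionCount k * overpartitionCount (k + 2) < overpartitionCount (k + 1) ^ 2 := by
  rcases lt_or_ge k 640 with h | h
  · exact logConcave_of_lt hk h
  · exact logConcave_of_ge (by lia)

lemma overpartitionCount_small : overpartitionCount 0 = 1 ∧ overpartitionCount 1 = 2 ∧
    overpartitionCount 2 = 4 ∧ overpartitionCount 3 = 8 := by
  have h := overpartitionList_four
  simp only [overpartitionList, List.cons.injEq] at h
  exact ⟨h.2.2.2.1, h.2.2.1, h.2.1, h.1⟩

lemma overpartitionCount_pos (n : ℕ) : 0 < overpartitionCount n := by
  rw [overpartitionCount_eq_sum]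
  exact Finset.sum_pos (fun p _ => by positivity) ⟨default, Finset.mem_univ _⟩

lemma logConcave_weak (k : ℕ) :
    overpartitionCount k * overpartitionCount (k + 2) ≤ overpartitionCount (k + 1) ^ 2 := by
  obtain ⟨h0, h1, h2, h3⟩ := overpartitionCount_small
  match k with
  | 0 => simp [h0, h1, h2]
  | 1 => simp [h1, h2, h3]
  | k + 2 => exact (logConcave (by lia)).le

/-- The ratios `p̄(k + 1) / p̄(k)` decrease. -/
lemma overpartitionCount_mul_le {i j : ℕ} (hij : i ≤ j) :
    overpartitionCount i * overpartitionCount (j + 1) ≤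
      overpartitionCount (i + 1) * overpartitionCount j := by
  induction j, hij using Nat.le_induction with
  | base => rw [mul_comm]
  | succ j _ ih =>
    have h := logConcave_weak j
    refine Nat.le_of_mul_le_mul_right ?_ (overpartitionCount_pos j)
    calc _ = overpartitionCount i * (overpartitionCount j * overpartitionCount (j + 2)) := by ring
      _ ≤ overpartitionCount i * overpartitionCount (j + 1) ^ 2 := by gcongr
      _ = (overpartitionCount i * overpartitionCount (j + 1)) * overpartitionCount (j + 1) := by
        ring
      _ ≤ (overpartitionCount (i + 1) * overpartitionCount j) * overpartitionCount (j + 1) := by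
        gcongr
      _ = _ := by ring

/-- The ratios `p̄(k + 1) / p̄(k)` decrease strictly from `k = 2` on. -/
lemma overpartitionCount_mul_lt {i j : ℕ} (hij : i < j) (hj : 3 ≤ j) :
    overpartitionCount i * overpartitionCount (j + 1) <
      overpartitionCount (i + 1) * overpartitionCount j := by
  obtain ⟨j, rfl⟩ : ∃ m, j = m + 1 := ⟨j - 1, by lia⟩
  have h := logConcave (k := j) (by lia)
  have ih := overpartitionCount_mul_le (i := i) (j := j) (by lia)
  have hi := overpartitionCount_pos i
  refine Nat.lt_of_mul_lt_mul_right (a := overpartitionCount j) ?_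
  calc _ = overpartitionCount i * (overpartitionCount j * overpartitionCount (j + 2)) := by ring
    _ < overpartitionCount i * overpartitionCount (j + 1) ^ 2 := by gcongr
    _ = (overpartitionCount i * overpartitionCount (j + 1)) * overpartitionCount (j + 1) := by
      ring
    _ ≤ (overpartitionCount (i + 1) * overpartitionCount j) * overpartitionCount (j + 1) := by
      gcongr
    _ = _ := by ring

lemma overpartitionCount_sub_mul_add_lt {n m : ℕ} (hn : 3 ≤ n) (hm : 1 ≤ m) (hmn : m ≤ n) :
    overpartitionCount (n - m) * overpartitionCount (n + m) < overpartitionCount n ^ 2 := by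
  induction m, hm using Nat.le_induction with
  | base =>
    have h := overpartitionCount_mul_lt (i := n - 1) (j := n) (by lia) hn
    rwa [Nat.sub_add_cancel (by lia), ← sq] at h
  | succ m _ ih =>
    have h := overpartitionCount_mul_lt (i := n - (m + 1)) (j := n + m) (by lia) (by lia)
    rw [show n - (m + 1) + 1 = n - m by lia] at h
    exact h.trans (ih (by lia))

lemma overpartitionCount_add_lt_of_le {a b : ℕ} (ha : 2 ≤ a) (hab : a ≤ b) :
    overpartitionCount (a + b) < overpartitionCount a * overpartitionCount b := by
  have h : ∀ i, 1 ≤ i → i ≤ a → overpartitionCount (a + b) <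
      overpartitionCount i * overpartitionCount (a + b - i) := by
    intro i hi
    induction i, hi using Nat.le_induction with
    | base =>
      intro _
      have h := overpartitionCount_mul_lt (i := 0) (j := a + b - 1) (by lia) (by lia)
      rwa [overpartitionCount_small.1, one_mul, Nat.sub_add_cancel (by lia)] at h
    | succ i _ ih =>
      intro hi'
      have h := overpartitionCount_mul_le (i := i) (j := a + b - (i + 1)) (by lia)
      rw [show a + b - (i + 1) + 1 = a + b - i by lia] at h
      exact (ih (by lia)).trans_le h
  simpa using h a (by lia) le_rfl

theorem theorem1p1 :
    (∀ n m : ℕ, 1 ≤ m → m < n →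
      0 ≤ (overpartitionCount n : ℤ) ^ 2
          - (overpartitionCount (n - m) : ℤ) * (overpartitionCount (n + m) : ℤ) ∧
      ((overpartitionCount n : ℤ) ^ 2
          - (overpartitionCount (n - m) : ℤ) * (overpartitionCount (n + m) : ℤ) = 0 ↔
        n = 2 ∧ m = 1)) ∧
    (∀ a b : ℕ, 1 < a → 1 < b →
      overpartitionCount (a + b) < overpartitionCount a * overpartitionCount b) := by
  refine ⟨fun n m hm hmn => ?_, fun a b ha hb => ?_⟩
  · rcases lt_or_ge n 3 with hn | hn
    · obtain ⟨rfl, rfl⟩ : n = 2 ∧ m = 1 := by lia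
      obtain ⟨h0, h1, h2, h3⟩ := overpartitionCount_small
      simp [h1, h2, h3]
    · have h := overpartitionCount_sub_mul_add_lt hn hm hmn.le
      zify at h
      refine ⟨by linarith, fun h0 => by linarith, fun h0 => by lia⟩
  · rcases le_total a b with hab | hab
    · exact overpartitionCount_add_lt_of_le ha hab
    · rw [add_comm, mul_comm]
      exact overpartitionCount_add_lt_of_le hb hab
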